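/- **Setting.** Let $M=(\mathcal S,\mathcal A,r,P,d_1,H)$ be a non-stationary finite-horizon tabular MDP with $S=|\mathcal S|<\infty$, $A=|\mathcal A|<\infty$, whose rewards lie in $[0,R_{\max}]$ almost surely. Under a (non-stationary, randomized) policy $\pi$ an episode $(s_1,a_1,r_1,\dots,s_H,a_H,r_H,s_{H+1})$ is generated by $s_1\sim d_1$, $a_t\sim\pi_t(\cdot|s_t)$, $s_{t+1}\sim P_t(\cdot|s_t,a_t)$, and a random reward $r_t$ drawn from its conditional law at step $t$. Let $v^\pi=\mathbb E_\pi[\sum_{t=1}^H r_t]$, and let $d^\pi_t(s)$, $d_t^\pi(s,a)$ be the state and state-action distributions at step $t$ under $\pi$. For a logging policy $\mu$ and a target policy $\pi$ put $\tau_s=\max_{t,s} d^\pi_t(s)/d^\mu_t(s)$ and $\tau_a=\max_{t,s,a}\pi_t(a|s)/\mu_t(a|s)$. From a data set of $m$ episodes let $n_{t,s,a}$ be the number of visits to $(s,a)$ at step $t$; let $\widehat P_{t}(s'|s,a)$ be the empirical frequency of the transition from $(s,a)$ at step $t$ to $s'$ at step $t+1$, and $\widehat r_t(s,a)$ the empirical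 mean reward, both set to $0$ if $n_{t,s,a}=0$. Let $\widehat d_1^\pi$ be the empirical distribution of $s_1$, $\widehat d^\pi_{t+1}(s')=\sum_{s,a}\widehat P_t(s'|s,a)\,\pi_t(a|s)\,\widehat d^\pi_t(s)$, and define the tabular marginalized importance sampling (TMIS) estimator $$\widehat v^\pi_{\mathrm{TMIS}}=\sum_{t=1}^H\sum_{s,a}\widehat d^\pi_t(s)\,\pi_t(a|s)\,\widehat r_t(s,a).$$ If $n=M\cdot N$ with integers $M,N>1$ and $n$ episodes are partitioned into $N$ folds of $M$ episodes, then $\widehat v^\pi_{\mathrm{split}}$ is the average of the $N$ TMIS estimators computed from the individual folds. **Theorem.** Let $c>0$, $K>0$ and $p_0\in\mathbb N$. There are constants $C_1,C_2,C_3>0$ and $p_1,p_3\in\mathbb N$, depending only on $c,K,p_0$, such that the following holds for all MDPs, policies $\mu,\pi$ and parameters $n=MN$ ($M,N>1$), $\delta\in(0,1)$ as above. Write $L=\log(SHAn/\delta)$. Suppose that $\mu$ is near-uniform, $\min_{t,s,a}d^\mu_t(s,a)\ge c/(SA)$, that the data are $n$ i.i.d. episodes generated by $\mu$, and that $$M\le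 K\,L^{p_0}\,nSA,\qquad M>\max\bigl[\,C_1\,SA\,L^{p_1},\ C_2\,H\tau_a\tau_s\,\bigr].$$ Then, for any fixed partition into folds, with probability at least $1-\delta$, $$\bigl|\widehat v^\pi_{\mathrm{split}}-v^\pi\bigr|\le C_3\,L^{p_3}\,R_{\max}\sqrt{\frac{H^2SA}{n}}.$$ -/

import Mathlib

namespace OPE

universe u v w

open MeasureTheory

/-- A non-stationary finite-horizon tabular MDP with horizon `H`. Time steps are indexed by `Fin H`
(so step `t` of the code is step `t + 1` in one-based notation). The random reward at step `t` has
an arbitrary law given the current state, the action and the next state. -/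
structure TabularMDP (S : Type u) (A : Type v) [Fintype S] (H : ℕ) where
  /-- initial state distribution -/
  init : S → ℝ
  init_mem : init ∈ stdSimplex ℝ S
  /-- `trans t s a s'` is the probability of moving to `s'` after taking action `a` in state `s` -/
  trans : Fin H → S → A → S → ℝ
  trans_mem : ∀ t s a, trans t s a ∈ stdSimplex ℝ S
  /-- `reward t s a s'` is the conditional law of the reward at step `t` -/
  reward : Fin H → S → A → S → ProbabilityMeasure ℝ

/-- A non-stationary randomized policy: `prob t s a` is the probability of action `a` in
state `s` at step `t`. -/
structure Policy (S : Type u) (A : Type v) [Fintype A] (H : ℕ) where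
  prob : Fin H → S → A → ℝ
  prob_mem : ∀ t s, prob t s ∈ stdSimplex ℝ A

/-- An episode: its `H + 1` states, its `H` actions and its `H` rewards. -/
abbrev Episode (S : Type u) (A : Type v) (H : ℕ) : Type (max u v) :=
  (Fin (H + 1) → S) × (Fin H → A) × (Fin H → ℝ)

namespace Episode

variable {S : Type u} {A : Type v} {H : ℕ}

/-- the state at step `t` (the last index is the state reached after the final action) -/
def state (ω : Episode S A H) (t : Fin (H + 1)) : S := ω.1 t

/-- the action at step `t` -/
def action (ω : Episode S A H) (t : Fin H) : A := ω.2.1 t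

/-- the reward at step `t` -/
def reward (ω : Episode S A H) (t : Fin H) : ℝ := ω.2.2 t

end Episode

namespace TabularMDP

variable {S : Type u} {A : Type v} [Fintype S] [Fintype A] [MeasurableSpace S] [MeasurableSpace A]
  {H : ℕ}

/-- The probability of the state sequence `x` and the action sequence `y` under the policy `π`. -/
noncomputable def pathProb (𝓜 : TabularMDP S A H) (π : Policy S A H)
    (x : Fin (H + 1) → S) (y : Fin H → A) : ℝ :=
  𝓜.init (x 0) *
    ∏ t : Fin H, π.prob t (x t.castSucc) (y t) * 𝓜.trans t (x t.castSucc) (y t) (x t.succ)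

/-- The law of one episode under the policy `π`: the states and actions follow `pathProb`, and,
given them, the rewards are drawn independently from their conditional laws. -/
noncomputable def episodeLaw (𝓜 : TabularMDP S A H) (π : Policy S A H) :
    Measure (Episode S A H) :=
  Measure.sum fun xy : (Fin (H + 1) → S) × (Fin H → A) =>
    ENNReal.ofReal (𝓜.pathProb π xy.1 xy.2) •
      (Measure.dirac xy.1).prod ((Measure.dirac xy.2).prod
        (Measure.pi fun t : Fin H =>
          (𝓜.reward t (xy.1 t.castSucc) (xy.2 t) (xy.1 t.succ) : Measure ℝ)))

/-- The value of the policy `π`: its expected total reward. -/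
noncomputable def value (𝓜 : TabularMDP S A H) (π : Policy S A H) : ℝ :=
  ∫ ω, ∑ t : Fin H, ω.reward t ∂(𝓜.episodeLaw π)

/-- The marginal state distribution at step `t` under `π`. -/
noncomputable def stateDist (𝓜 : TabularMDP S A H) (π : Policy S A H) (t : Fin H) (s : S) : ℝ :=
  (𝓜.episodeLaw π).real {ω | ω.state t.castSucc = s}

/-- The marginal state-action distribution at step `t` under `π`. -/
noncomputable def stateActionDist (𝓜 : TabularMDP S A H) (π : Policy S A H) (t : Fin H)
    (s : S) (a : A) : ℝ :=
  (𝓜.episodeLaw π).real {ω | ω.state t.castSucc = s ∧ ω.action t = a}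

/-- All rewards lie in `[0, Rmax]` almost surely. -/
def RewardsBounded (𝓜 : TabularMDP S A H) (Rmax : ℝ) : Prop :=
  ∀ t s a s', ∀ᵐ x ∂(𝓜.reward t s a s' : Measure ℝ), x ∈ Set.Icc 0 Rmax

/-- The policy `μ` is near-uniform with constant `c`: at every step every state-action pair is
visited with probability at least `c / (|S| |A|)`. -/
def NearUniform (𝓜 : TabularMDP S A H) (μ : Policy S A H) (c : ℝ) : Prop :=
  ∀ t s a, c / (Fintype.card S * Fintype.card A : ℝ) ≤ 𝓜.stateActionDist μ t s a

/-- The maximal state ratio `τ_s`. -/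
noncomputable def tauS (𝓜 : TabularMDP S A H) (π μ : Policy S A H) : ℝ :=
  ⨆ p : Fin H × S, 𝓜.stateDist π p.1 p.2 / 𝓜.stateDist μ p.1 p.2

end TabularMDP

/-- The maximal action ratio `τ_a`. -/
noncomputable def tauA {S : Type u} {A : Type v} [Fintype A] {H : ℕ} (π μ : Policy S A H) : ℝ :=
  ⨆ p : Fin H × S × A, π.prob p.1 p.2.1 p.2.2 / μ.prob p.1 p.2.1 p.2.2

section Estimator

variable {S : Type u} {A : Type v} [Fintype S] [Fintype A] {H : ℕ} {ι : Type w} [Fintype ι]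

open scoped Classical in
/-- The number of episodes of the data set `D` that visit `(s, a)` at step `t`. -/
noncomputable def visits (D : ι → Episode S A H) (t : Fin H) (s : S) (a : A) : ℕ :=
  (Finset.univ.filter fun i => (D i).state t.castSucc = s ∧ (D i).action t = a).card

open scoped Classical in
/-- The empirical transition probability; it is `0` if `(s, a)` is not visited at step `t`,
since then the denominator is `0`. -/
noncomputable def transHat (D : ι → Episode S A H) (t : Fin H) (s : S) (a : A) (s' : S) : ℝ :=
  ((Finset.univ.filter fun i => (D i).state t.castSucc = s ∧ (D i).action t = a ∧
    (D i).state t.succ = s').card : ℝ) / visits D t s a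

open scoped Classical in
/-- The empirical mean reward; it is `0` if `(s, a)` is not visited at step `t`. -/
noncomputable def rewardHat (D : ι → Episode S A H) (t : Fin H) (s : S) (a : A) : ℝ :=
  (∑ i, if (D i).state t.castSucc = s ∧ (D i).action t = a then (D i).reward t else 0) /
    visits D t s a

/-- The estimated state transition under `π`. -/
noncomputable def transPiHat (D : ι → Episode S A H) (π : Policy S A H) (t : Fin H) (s s' : S) :
    ℝ :=
  ∑ a, transHat D t s a s' * π.prob t s a

/-- The estimated mean reward of a state under `π`. -/
noncomputable def rewardPiHat (D : ι → Episode S A H) (π : Policy S A H) (t : Fin H) (s : S) : ℝ :=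
  ∑ a, rewardHat D t s a * π.prob t s a

open scoped Classical in
/-- The empirical distribution of the initial state. -/
noncomputable def initHat (D : ι → Episode S A H) (s : S) : ℝ :=
  ((Finset.univ.filter fun i => (D i).state 0 = s).card : ℝ) / Fintype.card ι

/-- The estimated marginal state distribution under `π`: it starts from the empirical initial
distribution and is propagated through the estimated transitions. -/
noncomputable def distHat (D : ι → Episode S A H) (π : Policy S A H) (t : Fin (H + 1)) : S → ℝ :=
  Fin.induction (motive := fun _ => S → ℝ) (initHat D)
    (fun t d s' => ∑ s, transPiHat D π t s s' * d s) t

/-- The tabular marginalized importance sampling estimator. -/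
noncomputable def tmis (D : ι → Episode S A H) (π : Policy S A H) : ℝ :=
  ∑ t : Fin H, ∑ s, distHat D π t.castSucc s * rewardPiHat D π t s

/-- The data-splitting estimator: the `n` episodes are partitioned into `N` folds of `M` episodes
(`e (i, j)` is the `j`-th episode of the `i`-th fold), and the estimators of the folds are
averaged. -/
noncomputable def splitTmis {n M N : ℕ} (e : Fin N × Fin M ≃ Fin n) (D : Fin n → Episode S A H)
    (π : Policy S A H) : ℝ :=
  (∑ i : Fin N, tmis (fun j : Fin M => D (e (i, j))) π) / N

end Estimator

/-- The logarithm `log (|S| H |A| n / δ)` whose powers measure polylogarithmic factors. -/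
noncomputable def logFactor (S : Type u) (A : Type v) [Fintype S] [Fintype A] (H n : ℕ) (δ : ℝ) :
    ℝ :=
  Real.log (Fintype.card S * H * Fintype.card A * n / δ)

end OPE

/-!
With the true value functions `V` of the target policy and the one-step returns
`X = r + V (s')`, the error of one TMIS estimator is, by the simulation lemma `tmis_sub_eq`, the
fluctuation of the initial states plus the sum over all steps and episodes of
`w * (X - E[X | s, a])`. Here `w` (`episodeWeight`) is the estimated occupation probability of
the visited pair divided by its number of visits. The weights depend only on the past, so this is a martingale. As the
logging policy is near-uniform, every pair is visited often (`measure_visits_lt_le`), and all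
weights are at most `1 / τ` with `τ` of order `M / (|S| |A|)`.

The quadratic variation of the martingale is at most `1 / τ` times the sum of `w * Var(X | s, a)`,
that is, a sum of conditional variances along the *estimated* chain. A telescoping argument for
the squared values, the law of total variance, bounds this sum by `2 (H R) ^ 2` minus the sum of
`w * (X ^ 2 - E[X ^ 2 | s, a])` (`sum_returnSqDev_le`), which is a martingale again, and whose
quadratic variation is controlled by the same sum of variances because squaring is Lipschitz on
`[0, H R]`. Hence one exponential supermartingale in `θ (X - E X) - φ (X ^ 2 - E X ^ 2)` with
`φ = 4 θ ^ 2 / τ` closes the estimate (`mul_tmis_sub_le`): the unknown variances cancel, and the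
sum of the errors of the `N` folds is sub-Gaussian with variance proxy of order
`N (H R) ^ 2 / τ` (`mul_sum_tmis_sub_le`). Treating all folds in one supermartingale gives the
factor `1 / √N` of the average. The resulting bound has the required order
`H R √(|S| |A| L / (M N))`.

The supermartingale property is reduced to finite sums: given the states and actions of all
episodes, the rewards are independent and are integrated first (`lintegral_data`), and then the
states and actions are summed out from the last step to the first (`sum_prod_adapted_le_one`,
`lintegral_data_le_one`).
-/

namespace OPE

open MeasureTheory Finset
open scoped ENNReal

/-! ### Adapted products over finite trees -/

/-- Splitting off the last coordinate of a sum over sequences of a product whose `t`-th factor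
depends only on the coordinates up to `t`; the value of the entry `e₀` is immaterial. -/
theorem sum_prod_adapted_succ {E R : Type*} [Fintype E] [CommSemiring R] {H : ℕ}
    (Q : Fin (H + 1) → (Fin (H + 1) → E) → R)
    (hQ : ∀ t z z', (∀ u ≤ t, z u = z' u) → Q t z = Q t z') (e₀ : E) :
    ∑ z, ∏ t, Q t z =
      ∑ z : Fin H → E, (∏ t : Fin H, Q t.castSucc (Fin.snoc (α := fun _ => E) z e₀)) *
        ∑ e, Q (Fin.last H)
          (Function.update (Fin.snoc (α := fun _ => E) z e₀) (Fin.last H) e) := by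
  rw [← (Fin.snocEquiv (fun _ => E)).sum_comp, Fintype.sum_prod_type, Finset.sum_comm]
  refine Finset.sum_congr rfl fun z _ => ?_
  rw [Finset.mul_sum]
  refine Finset.sum_congr rfl fun e _ => ?_
  rw [Fin.prod_univ_castSucc, Fin.update_snoc_last]
  congr 1
  refine Finset.prod_congr rfl fun t _ => hQ _ _ _ fun u hu => ?_
  have hu' : u ≠ Fin.last H := fun h => by
    have := t.castSucc_lt_last; rw [h] at hu; exact absurd hu (not_le.2 this)
  obtain ⟨v, rfl⟩ := Fin.exists_castSucc_eq.2 hu'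
  simp [Fin.snocEquiv]

theorem adapted_snoc {E R : Type*} {H : ℕ} (Q : Fin (H + 1) → (Fin (H + 1) → E) → R)
    (hQ : ∀ t z z', (∀ u ≤ t, z u = z' u) → Q t z = Q t z') (e₀ : E) (t : Fin H)
    (z z' : Fin H → E) (h : ∀ u ≤ t, z u = z' u) :
    Q t.castSucc (Fin.snoc (α := fun _ => E) z e₀) =
      Q t.castSucc (Fin.snoc (α := fun _ => E) z' e₀) := by
  refine hQ _ _ _ fun u hu => ?_
  have hu' : u ≠ Fin.last H := fun h => by
    have := t.castSucc_lt_last; rw [h] at hu; exact absurd hu (not_le.2 this)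
  obtain ⟨v, rfl⟩ := Fin.exists_castSucc_eq.2 hu'
  simpa using h v (by simpa using hu)

/-- A product of adapted sub-stochastic factors has total mass at most one. -/
theorem sum_prod_adapted_le_one {E : Type*} [Fintype E] : ∀ {H : ℕ}
    (Q : Fin H → (Fin H → E) → ℝ≥0∞),
    (∀ t z z', (∀ u ≤ t, z u = z' u) → Q t z = Q t z') →
    (∀ t z, ∑ e, Q t (Function.update z t e) ≤ 1) → ∑ z, ∏ t, Q t z ≤ 1
  | 0, _, _, _ => by simp
  | H + 1, Q, hQ, h1 => by
    rcases isEmpty_or_nonempty E with hE | ⟨⟨e₀⟩⟩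
    · have : IsEmpty (Fin (H + 1) → E) := ⟨fun z => hE.elim (z 0)⟩
      simp
    · rw [sum_prod_adapted_succ Q hQ e₀]
      refine (Finset.sum_le_sum fun z _ => mul_le_of_le_one_right' (h1 _ _)).trans ?_
      refine sum_prod_adapted_le_one
        (fun t z => Q t.castSucc (Fin.snoc (α := fun _ => E) z e₀))
        (fun t z z' h => adapted_snoc Q hQ e₀ t z z' h) fun t z => ?_
      simpa only [Fin.snoc_update] using h1 t.castSucc (Fin.snoc (α := fun _ => E) z e₀)

/-- A product of adapted stochastic (possibly signed) factors has total mass one. -/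
theorem sum_prod_adapted_eq_one {E : Type*} [Fintype E] [Nonempty E] : ∀ {H : ℕ}
    (Q : Fin H → (Fin H → E) → ℝ),
    (∀ t z z', (∀ u ≤ t, z u = z' u) → Q t z = Q t z') →
    (∀ t z, ∑ e, Q t (Function.update z t e) = 1) → ∑ z, ∏ t, Q t z = 1
  | 0, _, _, _ => by simp
  | H + 1, Q, hQ, h1 => by
    obtain ⟨e₀⟩ := ‹Nonempty E›
    rw [sum_prod_adapted_succ Q hQ e₀]
    simp only [h1, mul_one]
    refine sum_prod_adapted_eq_one
      (fun t z => Q t.castSucc (Fin.snoc (α := fun _ => E) z e₀))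
      (fun t z z' h => adapted_snoc Q hQ e₀ t z z' h) fun t z => ?_
    simpa only [Fin.snoc_update] using h1 t.castSucc (Fin.snoc (α := fun _ => E) z e₀)

/-! ### Sums over state-action paths -/

/-- The state path that starts in `x₀` and then follows the second components of `z`. -/
def pathOf {S A : Type*} {H : ℕ} (x₀ : S) (z : Fin H → A × S) : Fin (H + 1) → S :=
  Fin.cons x₀ fun t => (z t).2

theorem pathOf_zero {S A : Type*} {H : ℕ} (x₀ : S) (z : Fin H → A × S) :
    pathOf x₀ z 0 = x₀ := rfl

theorem pathOf_succ {S A : Type*} {H : ℕ} (x₀ : S) (z : Fin H → A × S) (t : Fin H) :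
    pathOf x₀ z t.succ = (z t).2 := by simp [pathOf]

theorem pathOf_congr {S A : Type*} {H : ℕ} (x₀ : S) {z z' : Fin H → A × S}
    {t : Fin (H + 1)} (h : ∀ u : Fin H, u.castSucc < t → (z u).2 = (z' u).2) :
    pathOf x₀ z t = pathOf x₀ z' t := by
  induction t using Fin.cases with
  | zero => rfl
  | succ t => rw [pathOf_succ, pathOf_succ, h t Fin.castSucc_lt_succ]

/-- A family of state-action paths, listed by initial states and then by the pairs of an action
and the state that it leads to, all members of the family advancing simultaneously. -/
def pathsEquiv (ι S A : Type*) (H : ℕ) :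
    (ι → S) × (Fin H → ι → A × S) ≃ (ι → (Fin (H + 1) → S) × (Fin H → A)) where
  toFun q k := (pathOf (q.1 k) (fun t => q.2 t k), fun t => (q.2 t k).1)
  invFun p := (fun k => (p k).1 0, fun t k => ((p k).2 t, (p k).1 t.succ))
  left_inv q := by ext <;> simp [pathOf_zero, pathOf_succ]
  right_inv p := by
    ext k t
    · induction t using Fin.cases with
      | zero => rfl
      | succ t => simp [pathOf_succ]
    · rfl

/-- The single-path version of `pathsEquiv`. -/
def pathEquiv (S A : Type*) (H : ℕ) :
    S × (Fin H → A × S) ≃ (Fin (H + 1) → S) × (Fin H → A) where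
  toFun q := (pathOf q.1 q.2, fun t => (q.2 t).1)
  invFun p := (p.1 0, fun t => (p.2 t, p.1 t.succ))
  left_inv q := by ext <;> simp [pathOf_zero, pathOf_succ]
  right_inv p := by
    ext t
    · induction t using Fin.cases with
      | zero => rfl
      | succ t => simp [pathOf_succ]
    · rfl

/-- A (possibly signed) Markov chain keeps the total mass of its initial weights. -/
theorem sum_markov {S A : Type*} [Fintype S] [Fintype A] {H : ℕ} (ι : S → ℝ)
    (Q : Fin H → S → A → S → ℝ) (hQ : ∀ t s, ∑ a, ∑ s', Q t s a s' = 1) :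
    ∑ xy : (Fin (H + 1) → S) × (Fin H → A),
      ι (xy.1 0) * ∏ t : Fin H, Q t (xy.1 t.castSucc) (xy.2 t) (xy.1 t.succ) = ∑ s, ι s := by
  rw [← (pathEquiv S A H).sum_comp, Fintype.sum_prod_type]
  refine Finset.sum_congr rfl fun x₀ _ => ?_
  simp only [pathEquiv, Equiv.coe_fn_mk, pathOf_zero, pathOf_succ, ← Finset.mul_sum]
  convert mul_one _
  rcases H with _ | H
  · simp
  have hne : Nonempty (A × S) := by
    by_contra h
    rw [not_nonempty_iff] at h
    have := hQ 0 x₀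
    rw [← Fintype.sum_prod_type'] at this
    simp at this
  refine sum_prod_adapted_eq_one
    (fun t z => Q t (pathOf x₀ z t.castSucc) (z t).1 (z t).2)
    (fun t z z' h => ?_) fun t z => ?_
  · rw [pathOf_congr x₀ (z' := z'), h t le_rfl]
    exact fun u hu => by rw [h u (Fin.castSucc_lt_castSucc_iff.1 hu).le]
  · rw [← hQ t (pathOf x₀ z t.castSucc), ← Fintype.sum_prod_type']
    refine Finset.sum_congr rfl fun e _ => ?_
    rw [pathOf_congr x₀ (z' := z)]
    · simp
    · intro u hu
      rw [Function.update_of_ne (Fin.castSucc_lt_castSucc_iff.1 hu).ne]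

namespace TabularMDP

variable {S A : Type*} [Fintype S] [Fintype A] {H : ℕ}

theorem pathProb_nonneg (𝓜 : TabularMDP S A H) (π : Policy S A H)
    (x : Fin (H + 1) → S) (y : Fin H → A) : 0 ≤ 𝓜.pathProb π x y :=
  mul_nonneg (𝓜.init_mem.1 _) <| Finset.prod_nonneg fun _ _ =>
    mul_nonneg ((π.prob_mem _ _).1 _) ((𝓜.trans_mem _ _ _).1 _)

theorem sum_pathProb (𝓜 : TabularMDP S A H) (π : Policy S A H) :
    ∑ xy : (Fin (H + 1) → S) × (Fin H → A), 𝓜.pathProb π xy.1 xy.2 = 1 := by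
  rw [← 𝓜.init_mem.2]
  refine sum_markov 𝓜.init (fun t s a s' => π.prob t s a * 𝓜.trans t s a s') fun t s => ?_
  simp [← Finset.mul_sum, (𝓜.trans_mem _ _ _).2, (π.prob_mem _ _).2]

/-- Along a path of the chain, an increment with conditional mean zero has mean zero.
The weight `1 + f` in place of `1` at step `t` leaves the total mass unchanged. -/
theorem sum_pathProb_mul_eq_zero (𝓜 : TabularMDP S A H) (π : Policy S A H) (t : Fin H)
    (f : S → A → S → ℝ)
    (hf : ∀ s, ∑ a, ∑ s', π.prob t s a * 𝓜.trans t s a s' * f s a s' = 0) :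
    ∑ xy : (Fin (H + 1) → S) × (Fin H → A),
      𝓜.pathProb π xy.1 xy.2 * f (xy.1 t.castSucc) (xy.2 t) (xy.1 t.succ) = 0 := by
  have h := sum_markov 𝓜.init
    (fun u s a s' => π.prob u s a * 𝓜.trans u s a s' * if u = t then 1 + f s a s' else 1)
    fun u s => by
      rcases eq_or_ne u t with rfl | hu
      · simp only [if_true, mul_add, Finset.sum_add_distrib, hf s, add_zero, mul_one]
        simp [← Finset.mul_sum, (𝓜.trans_mem _ _ _).2, (π.prob_mem _ _).2]
      · simp [hu, ← Finset.mul_sum, (𝓜.trans_mem _ _ _).2, (π.prob_mem _ _).2]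
  simp only [Finset.prod_mul_distrib, Finset.prod_ite_eq', Finset.mem_univ, if_true,
    𝓜.init_mem.2] at h
  have h2 := 𝓜.sum_pathProb π
  simp only [pathProb, Finset.prod_mul_distrib] at h2 ⊢
  rw [← sub_eq_zero.2 (h.trans h2.symm), ← Finset.sum_sub_distrib]
  exact Finset.sum_congr rfl fun xy _ => by ring

/-- The initial state of a path has law `init`. -/
theorem sum_pathProb_mul_init (𝓜 : TabularMDP S A H) (π : Policy S A H) (f : S → ℝ) :
    ∑ xy : (Fin (H + 1) → S) × (Fin H → A), 𝓜.pathProb π xy.1 xy.2 * f (xy.1 0) =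
      ∑ s, 𝓜.init s * f s := by
  rw [← sum_markov (fun s => 𝓜.init s * f s)
    (fun t s a s' => π.prob t s a * 𝓜.trans t s a s') fun t s => by
      simp [← Finset.mul_sum, (𝓜.trans_mem _ _ _).2, (π.prob_mem _ _).2]]
  exact Finset.sum_congr rfl fun xy _ => by rw [pathProb]; ring

end TabularMDP

/-! ### Integrals against the law of the data -/

theorem lintegral_pi_prod {ι : Type*} [Fintype ι] {E : ι → Type*} [∀ i, MeasurableSpace (E i)]
    (ν : ∀ i, Measure (E i)) [∀ i, IsProbabilityMeasure (ν i)] (f : ∀ i, E i → ℝ≥0∞)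
    (hf : ∀ i, Measurable (f i)) :
    ∫⁻ x, ∏ i, f i (x i) ∂Measure.pi ν = ∏ i, ∫⁻ x, f i x ∂ν i := by
  refine (ProbabilityTheory.lintegral_prod_eq_prod_lintegral_of_indepFun Finset.univ
    (fun i (x : ∀ i, E i) => f i (x i)) (ProbabilityTheory.iIndepFun_pi fun i => (hf i).aemeasurable)
    fun i => (hf i).comp (measurable_pi_apply i)).trans ?_
  exact Finset.prod_congr rfl fun i _ => (measurePreserving_eval ν i).lintegral_comp (hf i)

namespace Episode

/-- The states and actions of an episode, without its rewards. -/
def path {S A : Type*} {H : ℕ} (ω : Episode S A H) : (Fin (H + 1) → S) × (Fin H → A) :=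
  (ω.1, ω.2.1)

end Episode

theorem measurableEmbedding_path {S A : Type*} [MeasurableSpace S] [MeasurableSpace A]
    [MeasurableSingletonClass S] [MeasurableSingletonClass A] {H : ℕ}
    (xy : (Fin (H + 1) → S) × (Fin H → A)) :
    MeasurableEmbedding (fun r : Fin H → ℝ => (xy.1, xy.2, r)) :=
  (measurableEmbedding_prodMk_left xy.1).comp (measurableEmbedding_prodMk_left xy.2)

namespace TabularMDP

variable {S A : Type*} [Fintype S] [Fintype A] [MeasurableSpace S] [MeasurableSpace A]
  {H : ℕ}

/-- The joint law of the rewards given the states and the actions. -/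
noncomputable def rewardsLaw (𝓜 : TabularMDP S A H) (xy : (Fin (H + 1) → S) × (Fin H → A)) :
    Measure (Fin H → ℝ) :=
  Measure.pi fun t : Fin H => (𝓜.reward t (xy.1 t.castSucc) (xy.2 t) (xy.1 t.succ) : Measure ℝ)

instance (𝓜 : TabularMDP S A H) (xy : (Fin (H + 1) → S) × (Fin H → A)) :
    IsProbabilityMeasure (𝓜.rewardsLaw xy) := by
  unfold rewardsLaw; infer_instance

theorem episodeLaw_eq_sum (𝓜 : TabularMDP S A H) (π : Policy S A H) :
    𝓜.episodeLaw π = ∑ xy : (Fin (H + 1) → S) × (Fin H → A),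
      ENNReal.ofReal (𝓜.pathProb π xy.1 xy.2) •
        (𝓜.rewardsLaw xy).map (fun r => (xy.1, xy.2, r)) := by
  rw [episodeLaw, Measure.sum_fintype]
  refine Finset.sum_congr rfl fun xy _ => ?_
  rw [Measure.dirac_prod, Measure.dirac_prod, Measure.map_map (by fun_prop) (by fun_prop)]
  rfl

variable [MeasurableSingletonClass S] [MeasurableSingletonClass A]

theorem lintegral_episodeLaw (𝓜 : TabularMDP S A H) (π : Policy S A H)
    (F : Episode S A H → ℝ≥0∞) :
    ∫⁻ ω, F ω ∂𝓜.episodeLaw π = ∑ xy : (Fin (H + 1) → S) × (Fin H → A),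
      ENNReal.ofReal (𝓜.pathProb π xy.1 xy.2) * ∫⁻ r, F (xy.1, xy.2, r) ∂𝓜.rewardsLaw xy := by
  rw [episodeLaw_eq_sum, lintegral_finsetSum_measure]
  refine Finset.sum_congr rfl fun xy _ => ?_
  rw [lintegral_smul_measure, (measurableEmbedding_path xy).lintegral_map]
  rfl

instance (𝓜 : TabularMDP S A H) (π : Policy S A H) :
    IsProbabilityMeasure (𝓜.episodeLaw π) := ⟨by
  rw [← lintegral_one, lintegral_episodeLaw]
  simp only [lintegral_one, measure_univ, mul_one]
  rw [← ENNReal.ofReal_sum_of_nonneg fun xy _ => 𝓜.pathProb_nonneg π _ _, sum_pathProb,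
    ENNReal.ofReal_one]⟩

theorem ae_reward_mem (𝓜 : TabularMDP S A H) (π : Policy S A H) {R : ℝ}
    (hR : 𝓜.RewardsBounded R) (t : Fin H) :
    ∀ᵐ ω ∂𝓜.episodeLaw π, ω.reward t ∈ Set.Icc 0 R := by
  rw [episodeLaw_eq_sum, ← Measure.sum_fintype, Measure.ae_sum_iff]
  intro xy
  refine Measure.ae_smul_measure ?_ _
  rw [(measurableEmbedding_path xy).ae_map_iff]
  exact (Measure.quasiMeasurePreserving_eval _ t).ae (hR t _ _ _)

open scoped Classical in
/-- The expectation of a function that is, given the paths of all episodes, a product of functions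
of the individual rewards. -/
theorem lintegral_data (𝓜 : TabularMDP S A H) (π : Policy S A H) {ι : Type*} [Fintype ι]
    (c : (ι → (Fin (H + 1) → S) × (Fin H → A)) → ℝ≥0∞)
    (Φ : (ι → (Fin (H + 1) → S) × (Fin H → A)) → ι → Fin H → ℝ → ℝ≥0∞)
    (hΦ : ∀ p k t, Measurable (Φ p k t)) :
    Measurable (fun D : ι → Episode S A H => c (fun k => (D k).path) *
      ∏ k, ∏ t, Φ (fun k => (D k).path) k t ((D k).reward t)) ∧
    ∫⁻ D, c (fun k => (D k).path) * ∏ k, ∏ t, Φ (fun k => (D k).path) k t ((D k).reward t)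
        ∂(Measure.pi fun _ : ι => 𝓜.episodeLaw π) =
      ∑ p, c p * ∏ k, (ENNReal.ofReal (𝓜.pathProb π (p k).1 (p k).2) *
        ∏ t, ∫⁻ r, Φ p k t r
          ∂(𝓜.reward t ((p k).1 t.castSucc) ((p k).2 t) ((p k).1 t.succ) : Measure ℝ)) := by
  have hpath : Measurable (Episode.path : Episode S A H → _) := by
    unfold Episode.path; fun_prop
  have hm : ∀ (p : ι → (Fin (H + 1) → S) × (Fin H → A)) (k : ι),
      Measurable fun ω : Episode S A H =>
        if ω.path = p k then ∏ t, Φ p k t (ω.reward t) else 0 := fun p k => by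
    refine Measurable.ite (hpath (measurableSet_singleton _)) ?_ measurable_const
    refine Finset.measurable_prod _ fun t _ => (hΦ p k t).comp ?_
    unfold Episode.reward; fun_prop
  have hF : (fun D : ι → Episode S A H => c (fun k => (D k).path) *
      ∏ k, ∏ t, Φ (fun k => (D k).path) k t ((D k).reward t)) =
      fun D => ∑ p, c p * ∏ k, if (D k).path = p k then ∏ t, Φ p k t ((D k).reward t) else 0 := by
    ext D
    rw [Finset.sum_eq_single (fun k => (D k).path)]
    · simp
    · intro p _ hp
      obtain ⟨k, hk⟩ := Function.ne_iff.1 hp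
      rw [Finset.prod_eq_zero (Finset.mem_univ k) (if_neg hk.symm), mul_zero]
    · simp
  have hm2 : ∀ p : ι → (Fin (H + 1) → S) × (Fin H → A), Measurable fun D : ι → Episode S A H =>
      ∏ k, if (D k).path = p k then ∏ t, Φ p k t ((D k).reward t) else 0 := fun p =>
    Finset.measurable_prod _ fun k _ => (hm p k).comp (measurable_pi_apply k)
  rw [hF]
  refine ⟨Finset.measurable_sum _ fun p _ => (hm2 p).const_mul _, ?_⟩
  rw [lintegral_finsetSum _ fun p _ => (hm2 p).const_mul _]
  refine Finset.sum_congr rfl fun p _ => ?_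
  rw [lintegral_const_mul _ (hm2 p), lintegral_pi_prod _ _ (hm p)]
  congr 1
  refine Finset.prod_congr rfl fun k _ => ?_
  rw [lintegral_episodeLaw, Finset.sum_eq_single (p k)]
  · simp only [Episode.path, Episode.reward, Prod.mk.eta, if_true, rewardsLaw]
    rw [lintegral_pi_prod _ _ (hΦ p k)]
  · intro xy _ hxy
    simp [Episode.path, hxy]
  · simp

end TabularMDP

/-! ### Value functions and the law of the one-step return -/

theorem sum_succ_sub_castSucc {H : ℕ} (f : Fin (H + 1) → ℝ) :
    ∑ t : Fin H, (f t.succ - f t.castSucc) = f (Fin.last H) - f 0 := by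
  have h := (Fin.sum_univ_succ f).symm.trans (Fin.sum_univ_castSucc f)
  rw [Finset.sum_sub_distrib]
  linarith

theorem integrable_of_mem_Icc {ν : Measure ℝ} [IsFiniteMeasure ν] {a b : ℝ}
    (h : ∀ᵐ x ∂ν, x ∈ Set.Icc a b) : Integrable (fun x => x) ν :=
  Integrable.of_mem_Icc a b aemeasurable_id h

theorem integral_mem_Icc {Ω : Type*} [MeasurableSpace Ω] {ν : Measure Ω} [IsProbabilityMeasure ν]
    {f : Ω → ℝ} (hf : AEMeasurable f ν) {b : ℝ} (h : ∀ᵐ x ∂ν, f x ∈ Set.Icc 0 b) :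
    ∫ x, f x ∂ν ∈ Set.Icc 0 b := by
  refine ⟨integral_nonneg_of_ae (h.mono fun x hx => hx.1), ?_⟩
  calc ∫ x, f x ∂ν ≤ ∫ _, b ∂ν :=
        integral_mono_ae (Integrable.of_mem_Icc 0 b hf h) (integrable_const _)
          (h.mono fun x hx => hx.2)
    _ = b := by simp

namespace TabularMDP

variable {S A : Type*} [Fintype S] {H : ℕ}

/-- The law of `r + V s'` when the action `a` is taken in the state `s` at step `t`, the reward `r`
is received and the next state is `s'`. -/
noncomputable def bootstrapLaw (𝓜 : TabularMDP S A H) (V : S → ℝ) (t : Fin H) (s : S) (a : A) :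
    Measure ℝ :=
  ∑ s', ENNReal.ofReal (𝓜.trans t s a s') •
    (𝓜.reward t s a s' : Measure ℝ).map (fun r => r + V s')

theorem lintegral_bootstrapLaw (𝓜 : TabularMDP S A H) (V : S → ℝ) (t : Fin H) (s : S) (a : A)
    (f : ℝ → ℝ≥0∞) (hf : Measurable f) :
    ∫⁻ x, f x ∂𝓜.bootstrapLaw V t s a = ∑ s', ENNReal.ofReal (𝓜.trans t s a s') *
      ∫⁻ r, f (r + V s') ∂(𝓜.reward t s a s' : Measure ℝ) := by
  rw [bootstrapLaw, lintegral_finsetSum_measure]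
  refine Finset.sum_congr rfl fun s' _ => ?_
  rw [lintegral_smul_measure, lintegral_map hf (by fun_prop)]
  rfl

instance (𝓜 : TabularMDP S A H) (V : S → ℝ) (t : Fin H) (s : S) (a : A) :
    IsProbabilityMeasure (𝓜.bootstrapLaw V t s a) := ⟨by
  rw [← lintegral_one, lintegral_bootstrapLaw _ _ _ _ _ _ measurable_const]
  simp only [lintegral_one, measure_univ, mul_one]
  rw [← ENNReal.ofReal_sum_of_nonneg fun s' _ => (𝓜.trans_mem t s a).1 s', (𝓜.trans_mem t s a).2,
    ENNReal.ofReal_one]⟩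

theorem ae_bootstrapLaw_mem (𝓜 : TabularMDP S A H) {R : ℝ} (hR : 𝓜.RewardsBounded R)
    {V : S → ℝ} {b : ℝ} (hV : ∀ s, V s ∈ Set.Icc 0 b) (t : Fin H) (s : S) (a : A) :
    ∀ᵐ x ∂𝓜.bootstrapLaw V t s a, x ∈ Set.Icc 0 (R + b) := by
  rw [bootstrapLaw, ← Measure.sum_fintype, Measure.ae_sum_iff]
  intro s'
  refine Measure.ae_smul_measure ?_ _
  refine (ae_map_iff (by fun_prop) measurableSet_Icc).2 ?_
  filter_upwards [hR t s a s'] with r hr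
  exact ⟨add_nonneg hr.1 (hV s').1, add_le_add hr.2 (hV s').2⟩

theorem integral_bootstrapLaw (𝓜 : TabularMDP S A H) {R : ℝ} (hR : 𝓜.RewardsBounded R)
    (V : S → ℝ) (t : Fin H) (s : S) (a : A) :
    ∫ x, x ∂𝓜.bootstrapLaw V t s a =
      ∑ s', 𝓜.trans t s a s' * (∫ r, r ∂(𝓜.reward t s a s' : Measure ℝ) + V s') := by
  have hint : ∀ s', Integrable (fun r => r) (𝓜.reward t s a s' : Measure ℝ) := fun s' =>
    integrable_of_mem_Icc (hR t s a s')
  rw [bootstrapLaw, integral_finsetSum_measure]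
  · refine Finset.sum_congr rfl fun s' _ => ?_
    rw [integral_smul_measure, integral_map (by fun_prop) (by fun_prop),
      ENNReal.toReal_ofReal ((𝓜.trans_mem t s a).1 s'), integral_add (hint s') (by fun_prop)]
    simp
  · intro s' _
    refine Integrable.smul_measure ?_ (by simp)
    rw [integrable_map_measure (by fun_prop) (by fun_prop)]
    exact (hint s').add (integrable_const _)

variable [Fintype A]

/-- The value function of the policy `π`, by backward recursion from `0` after the last step. -/
noncomputable def stateValue (𝓜 : TabularMDP S A H) (π : Policy S A H) :
    Fin (H + 1) → S → ℝ :=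
  Fin.reverseInduction (motive := fun _ => S → ℝ) (fun _ => 0)
    fun t V s => ∑ a, π.prob t s a * ∫ x, x ∂𝓜.bootstrapLaw V t s a

/-- The law of the one-step return: the reward at step `t` plus the value of the next state. -/
noncomputable def returnLaw (𝓜 : TabularMDP S A H) (π : Policy S A H) (t : Fin H) (s : S)
    (a : A) : Measure ℝ :=
  𝓜.bootstrapLaw (𝓜.stateValue π t.succ) t s a

instance (𝓜 : TabularMDP S A H) (π : Policy S A H) (t : Fin H) (s : S) (a : A) :
    IsProbabilityMeasure (𝓜.returnLaw π t s a) := by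
  unfold returnLaw; infer_instance

/-- The expected one-step return, that is, the action value of `π`. -/
noncomputable def actionValue (𝓜 : TabularMDP S A H) (π : Policy S A H) (t : Fin H) (s : S)
    (a : A) : ℝ :=
  ∫ x, x ∂𝓜.returnLaw π t s a

/-- The second moment of the one-step return. -/
noncomputable def returnSq (𝓜 : TabularMDP S A H) (π : Policy S A H) (t : Fin H) (s : S)
    (a : A) : ℝ :=
  ∫ x, x ^ 2 ∂𝓜.returnLaw π t s a

theorem stateValue_last (𝓜 : TabularMDP S A H) (π : Policy S A H) (s : S) :
    𝓜.stateValue π (Fin.last H) s = 0 := by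
  simp [stateValue]

theorem stateValue_castSucc (𝓜 : TabularMDP S A H) (π : Policy S A H) (t : Fin H) (s : S) :
    𝓜.stateValue π t.castSucc s = ∑ a, π.prob t s a * 𝓜.actionValue π t s a := by
  simp only [stateValue, Fin.reverseInduction_castSucc, actionValue, returnLaw]

theorem stateValue_mem (𝓜 : TabularMDP S A H) (π : Policy S A H) {R : ℝ}
    (hR : 𝓜.RewardsBounded R) (t : Fin (H + 1)) (s : S) :
    𝓜.stateValue π t s ∈ Set.Icc 0 ((H - (t : ℕ)) * R) := by
  induction t using Fin.reverseInduction generalizing s with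
  | last => simp [stateValue_last]
  | cast t ih =>
    have h : ∀ a, 𝓜.actionValue π t s a ∈ Set.Icc 0 (R + (H - (t.succ : ℕ)) * R) := fun a =>
      integral_mem_Icc aemeasurable_id (𝓜.ae_bootstrapLaw_mem hR ih t s a)
    rw [stateValue_castSucc]
    refine ⟨Finset.sum_nonneg fun a _ => mul_nonneg ((π.prob_mem t s).1 a) (h a).1, ?_⟩
    calc ∑ a, π.prob t s a * 𝓜.actionValue π t s a
        ≤ ∑ a, π.prob t s a * (R + (H - (t.succ : ℕ)) * R) :=
          Finset.sum_le_sum fun a _ =>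
            mul_le_mul_of_nonneg_left (h a).2 ((π.prob_mem t s).1 a)
      _ = _ := by
        rw [← Finset.sum_mul, (π.prob_mem t s).2]
        simp only [Fin.val_succ, Fin.val_castSucc]
        push_cast; ring

theorem stateValue_mem' (𝓜 : TabularMDP S A H) (π : Policy S A H) {R : ℝ} (hR0 : 0 ≤ R)
    (hR : 𝓜.RewardsBounded R) (t : Fin (H + 1)) (s : S) :
    𝓜.stateValue π t s ∈ Set.Icc 0 (H * R) := by
  have h := 𝓜.stateValue_mem π hR t s
  refine ⟨h.1, h.2.trans ?_⟩
  gcongr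
  simp

/-- One reward and the value of the next state add up to at most the total of all rewards. -/
theorem reward_add_stateValue_mem (𝓜 : TabularMDP S A H) (π : Policy S A H) {R : ℝ}
    (hR0 : 0 ≤ R) (hR : 𝓜.RewardsBounded R) (t : Fin H) (s : S) {r : ℝ} (hr : r ∈ Set.Icc 0 R) :
    r + 𝓜.stateValue π t.succ s ∈ Set.Icc 0 (H * R) := by
  have h := 𝓜.stateValue_mem π hR t.succ s
  refine ⟨add_nonneg hr.1 h.1, (add_le_add hr.2 h.2).trans ?_⟩
  have : 0 ≤ (t : ℕ) * R := by positivity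
  simp only [Fin.val_succ]
  push_cast
  linarith

theorem ae_returnLaw_mem (𝓜 : TabularMDP S A H) (π : Policy S A H) {R : ℝ} (hR0 : 0 ≤ R)
    (hR : 𝓜.RewardsBounded R) (t : Fin H) (s : S) (a : A) :
    ∀ᵐ x ∂𝓜.returnLaw π t s a, x ∈ Set.Icc 0 (H * R) := by
  filter_upwards [𝓜.ae_bootstrapLaw_mem hR (𝓜.stateValue_mem π hR t.succ) t s a] with x hx
  refine ⟨hx.1, hx.2.trans ?_⟩
  have : 0 ≤ (t : ℕ) * R := by positivity
  simp only [Fin.val_succ]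
  push_cast
  linarith

/-- The value of `π` is the mean of its value function under the initial distribution. -/
theorem value_eq_sum_init [MeasurableSpace S] [MeasurableSpace A] [MeasurableSingletonClass S]
    [MeasurableSingletonClass A] (𝓜 : TabularMDP S A H) (π : Policy S A H) {R : ℝ}
    (hR : 𝓜.RewardsBounded R) :
    𝓜.value π = ∑ s, 𝓜.init s * 𝓜.stateValue π 0 s := by
  have hint : ∀ xy : (Fin (H + 1) → S) × (Fin H → A), ∀ t : Fin H,
      Integrable (fun r : Fin H → ℝ => r t) (𝓜.rewardsLaw xy) := fun xy t =>
    (measurePreserving_eval (fun t : Fin H =>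
      (𝓜.reward t (xy.1 t.castSucc) (xy.2 t) (xy.1 t.succ) : Measure ℝ))
      t).integrable_comp_of_integrable (g := fun x : ℝ => x) (integrable_of_mem_Icc (hR t _ _ _))
  have h1 : 𝓜.value π = ∑ xy : (Fin (H + 1) → S) × (Fin H → A), 𝓜.pathProb π xy.1 xy.2 *
      ∑ t, ∫ r, r ∂(𝓜.reward t (xy.1 t.castSucc) (xy.2 t) (xy.1 t.succ) : Measure ℝ) := by
    rw [value, episodeLaw_eq_sum, integral_finsetSum_measure]
    · refine Finset.sum_congr rfl fun xy _ => ?_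
      rw [integral_smul_measure, (measurableEmbedding_path xy).integral_map,
        ENNReal.toReal_ofReal (𝓜.pathProb_nonneg π _ _), smul_eq_mul]
      simp only [Episode.reward]
      rw [integral_finsetSum _ fun t _ => hint xy t]
      congr 1
      refine Finset.sum_congr rfl fun t _ => ?_
      exact integral_comp_eval (X := fun _ : Fin H => ℝ)
        (μ := fun t => (𝓜.reward t (xy.1 t.castSucc) (xy.2 t) (xy.1 t.succ) : Measure ℝ))
        (f := fun x : ℝ => x) (by fun_prop)
    · intro xy _
      refine Integrable.smul_measure ?_ (by simp)
      rw [(measurableEmbedding_path xy).integrable_map_iff]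
      exact integrable_finsetSum _ fun t _ => hint xy t
  have h2 : ∀ t : Fin H, ∑ xy : (Fin (H + 1) → S) × (Fin H → A), 𝓜.pathProb π xy.1 xy.2 *
      (∫ r, r ∂(𝓜.reward t (xy.1 t.castSucc) (xy.2 t) (xy.1 t.succ) : Measure ℝ) +
        𝓜.stateValue π t.succ (xy.1 t.succ) - 𝓜.stateValue π t.castSucc (xy.1 t.castSucc)) = 0 :=
    fun t => 𝓜.sum_pathProb_mul_eq_zero π t (fun s a s' =>
      ∫ r, r ∂(𝓜.reward t s a s' : Measure ℝ) + 𝓜.stateValue π t.succ s' -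
        𝓜.stateValue π t.castSucc s) fun s => by
      simp only [mul_assoc, ← Finset.mul_sum, mul_sub, Finset.sum_sub_distrib, ← Finset.sum_mul,
        (𝓜.trans_mem _ _ _).2, one_mul, (π.prob_mem _ _).2]
      rw [stateValue_castSucc, sub_eq_zero]
      refine Finset.sum_congr rfl fun a _ => ?_
      rw [actionValue, returnLaw, 𝓜.integral_bootstrapLaw hR]
  rw [← 𝓜.sum_pathProb_mul_init π, h1, ← sub_eq_zero, ← Finset.sum_sub_distrib,
    ← Finset.sum_eq_zero fun t (_ : t ∈ Finset.univ) => h2 t, Finset.sum_comm]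
  refine Finset.sum_congr rfl fun xy _ => ?_
  have h3 := sum_succ_sub_castSucc fun t => 𝓜.stateValue π t (xy.1 t)
  rw [stateValue_last] at h3
  rw [← Finset.mul_sum, ← mul_sub]
  simp only [add_sub_assoc, Finset.sum_add_distrib, h3]
  ring

end TabularMDP

/-! ### Exponential moments -/

/-- Bernstein's bound: a centred function `f` with values in `[-1, 1]` and second moment at most
`v` has `∫ exp f ≤ exp v`. The second moment is bounded through a majorant `g` of `f ^ 2`. -/
theorem lintegral_exp_sub_le_one {Ω : Type*} [MeasurableSpace Ω] {ν : Measure Ω}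
    [IsProbabilityMeasure ν] {f g : Ω → ℝ} {v : ℝ} (hf : Integrable f ν) (hg : Integrable g ν)
    (hf0 : ∫ x, f x ∂ν = 0) (h1 : ∀ᵐ x ∂ν, |f x| ≤ 1) (hfg : ∀ᵐ x ∂ν, f x ^ 2 ≤ g x)
    (hv : ∫ x, g x ∂ν ≤ v) :
    ∫⁻ x, ENNReal.ofReal (Real.exp (f x - v)) ∂ν ≤ 1 := by
  have hi : Integrable (fun x => (1 + f x + g x) * Real.exp (-v)) ν :=
    (((integrable_const 1).add hf).add hg).mul_const _
  have hle : ∀ᵐ x ∂ν, Real.exp (f x - v) ≤ (1 + f x + g x) * Real.exp (-v) := by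
    filter_upwards [h1, hfg] with x hx hx2
    rw [sub_eq_add_neg, Real.exp_add]
    have := (abs_le.1 (Real.abs_exp_sub_one_sub_id_le hx)).2
    gcongr
    linarith
  calc ∫⁻ x, ENNReal.ofReal (Real.exp (f x - v)) ∂ν
      ≤ ∫⁻ x, ENNReal.ofReal ((1 + f x + g x) * Real.exp (-v)) ∂ν :=
        lintegral_mono_ae (hle.mono fun x hx => ENNReal.ofReal_le_ofReal hx)
    _ = ENNReal.ofReal (∫ x, (1 + f x + g x) * Real.exp (-v) ∂ν) :=
        (ofReal_integral_eq_lintegral_ofReal hi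
          (hle.mono fun x hx => (Real.exp_pos _).le.trans hx)).symm
    _ ≤ 1 := by
      rw [← ENNReal.ofReal_one]
      refine ENNReal.ofReal_le_ofReal ?_
      rw [integral_mul_const, integral_add (by fun_prop) hg, integral_add (by fun_prop) hf, hf0]
      simp only [integral_const, probReal_univ, smul_eq_mul, mul_one, add_zero]
      rw [Real.exp_neg, ← div_eq_mul_inv, div_le_one (Real.exp_pos _)]
      linarith [Real.add_one_le_exp v]

/-- The exponential moment of a combination of a bounded variable and its square, both centred,
is governed by the variance of the variable itself, since squaring is Lipschitz on `[0, B]`. -/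
theorem lintegral_exp_centred_le_one {ν : Measure ℝ} [IsProbabilityMeasure ν] {B : ℝ}
    (hν : ∀ᵐ x ∂ν, x ∈ Set.Icc 0 B) {w θ φ : ℝ} (hw : 0 ≤ w) (hφ : 0 ≤ φ)
    (hB : w * (|θ| * B + φ * B ^ 2) ≤ 1) {q m : ℝ} (hq : ∫ x, x ∂ν = q)
    (hm : ∫ x, x ^ 2 ∂ν = m) :
    ∫⁻ x, ENNReal.ofReal (Real.exp (w * (θ * (x - q) - φ * (x ^ 2 - m)) -
      w ^ 2 * (2 * θ ^ 2 + 8 * φ ^ 2 * B ^ 2) * (m - q ^ 2))) ∂ν ≤ 1 := by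
  have hB0 : 0 ≤ B := by
    obtain ⟨x, hx⟩ := hν.exists
    exact hx.1.trans hx.2
  have hi1 : Integrable (fun x : ℝ => x) ν := integrable_of_mem_Icc hν
  have hν2 : ∀ᵐ x ∂ν, x ^ 2 ∈ Set.Icc 0 (B ^ 2) := hν.mono fun x hx =>
    ⟨sq_nonneg x, pow_le_pow_left₀ hx.1 hx.2 2⟩
  have hi2 : Integrable (fun x : ℝ => x ^ 2) ν :=
    Integrable.of_mem_Icc 0 (B ^ 2) (by fun_prop) hν2
  have hqm : q ∈ Set.Icc 0 B := hq ▸ integral_mem_Icc aemeasurable_id hν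
  have hmm : m ∈ Set.Icc 0 (B ^ 2) := hm ▸ integral_mem_Icc (by fun_prop) hν2
  have hquad : ∀ a b c : ℝ, Integrable (fun x => a * x ^ 2 + b * x + c) ν ∧
      ∫ x, a * x ^ 2 + b * x + c ∂ν = a * m + b * q + c := fun a b c => by
    have h1 := hi2.const_mul a
    have h2 := hi1.const_mul b
    refine ⟨(h1.add h2).add (integrable_const c), ?_⟩
    have h12 : Integrable (fun x => a * x ^ 2 + b * x) ν := h1.add h2
    rw [integral_add h12 (integrable_const c), integral_add h1 h2,
      integral_const_mul, integral_const_mul, hq, hm]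
    simp
  have hlin := hquad (-(w * φ)) (w * θ) (w * (φ * m - θ * q))
  -- the square of the variable is compared with the square of its mean rather than with `m`;
  -- this leaves a quadratic polynomial that is integrated exactly
  set d := m - q ^ 2
  have hd := hquad (w ^ 2 * (2 * θ ^ 2 + 8 * φ ^ 2 * B ^ 2) - 4 * w ^ 2 * φ ^ 2 * d)
    (-(2 * w ^ 2 * (2 * θ ^ 2 + 8 * φ ^ 2 * B ^ 2) * q))
    (w ^ 2 * (2 * θ ^ 2 + 8 * φ ^ 2 * B ^ 2) * q ^ 2 + 4 * w ^ 2 * φ ^ 2 * d * q ^ 2 +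
      2 * w ^ 2 * φ ^ 2 * d ^ 2)
  refine lintegral_exp_sub_le_one (f := fun x => w * (θ * (x - q) - φ * (x ^ 2 - m)))
    (hlin.1.congr (.of_forall fun x => by ring)) hd.1 ?_ ?_ ?_ ?_
  · refine (integral_congr_ae (.of_forall fun x => ?_)).trans (hlin.2.trans (by ring))
    ring
  · filter_upwards [hν, hν2] with x hx hx2
    rw [abs_mul, abs_of_nonneg hw]
    refine (mul_le_mul_of_nonneg_left ((abs_sub _ _).trans ?_) hw).trans hB
    rw [abs_mul, abs_mul, abs_of_nonneg hφ]
    gcongr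
    · exact abs_sub_le_of_nonneg_of_le hx.1 hx.2 hqm.1 hqm.2
    · exact abs_sub_le_of_nonneg_of_le hx2.1 hx2.2 hmm.1 hmm.2
  · filter_upwards [hν] with x hx
    have h1 : (x ^ 2 - q ^ 2) ^ 2 ≤ 4 * B ^ 2 * (x - q) ^ 2 := by
      have : (x + q) ^ 2 ≤ (2 * B) ^ 2 :=
        pow_le_pow_left₀ (add_nonneg hx.1 hqm.1) (by linarith [hx.2, hqm.2]) 2
      nlinarith [mul_le_mul_of_nonneg_right this (sq_nonneg (x - q))]
    have h2 : (θ * (x - q) - φ * (x ^ 2 - m)) ^ 2 ≤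
        2 * θ ^ 2 * (x - q) ^ 2 + 2 * φ ^ 2 * (x ^ 2 - m) ^ 2 := by
      nlinarith [sq_nonneg (θ * (x - q) + φ * (x ^ 2 - m))]
    have h3 : (x ^ 2 - m) ^ 2 ≤
        4 * B ^ 2 * (x - q) ^ 2 - 2 * (x ^ 2 - q ^ 2) * d + d ^ 2 := by
      have : x ^ 2 - m = (x ^ 2 - q ^ 2) - d := by simp only [d]; ring
      rw [this]
      nlinarith
    have h4 := mul_le_mul_of_nonneg_left h3 (by positivity : 0 ≤ 2 * φ ^ 2)
    have h5 := mul_le_mul_of_nonneg_left (h2.trans (add_le_add_right h4 _)) (sq_nonneg w)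
    rw [mul_pow]
    refine h5.trans (le_of_eq ?_)
    ring
  · rw [hd.2]
    have : 0 ≤ w ^ 2 * φ ^ 2 * d ^ 2 := by positivity
    have hm' : m = d + q ^ 2 := by simp only [d]; ring
    rw [hm']
    nlinarith

namespace TabularMDP

variable {S A : Type*} [Fintype S] [Fintype A] {H : ℕ}

theorem ofReal_pathProb (𝓜 : TabularMDP S A H) (μ : Policy S A H) (x : Fin (H + 1) → S)
    (y : Fin H → A) :
    ENNReal.ofReal (𝓜.pathProb μ x y) = ENNReal.ofReal (𝓜.init (x 0)) *
      ∏ t : Fin H, (ENNReal.ofReal (μ.prob t (x t.castSucc) (y t)) *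
        ENNReal.ofReal (𝓜.trans t (x t.castSucc) (y t) (x t.succ))) := by
  rw [pathProb, ENNReal.ofReal_mul (𝓜.init_mem.1 _), ENNReal.ofReal_prod_of_nonneg fun t _ =>
    mul_nonneg ((μ.prob_mem _ _).1 _) ((𝓜.trans_mem _ _ _).1 _)]
  congr 1
  exact Finset.prod_congr rfl fun t _ => ENNReal.ofReal_mul ((μ.prob_mem _ _).1 _)

/-- One simultaneous step of all chains: the weights `W` see the actions of all chains but not yet
the states that follow them. -/
theorem sum_step_le_one (𝓜 : TabularMDP S A H) (μ : Policy S A H) {ι : Type*} [Fintype ι]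
    [DecidableEq ι] (t : Fin H) (σ : ι → S) (W : (ι → A) → ι → ℝ) (I : ℝ → S → A → S → ℝ≥0∞)
    (h : ∀ a k, ∑ s', ENNReal.ofReal (𝓜.trans t (σ k) (a k) s') * I (W a k) (σ k) (a k) s' ≤ 1) :
    ∑ e : ι → A × S, ∏ k, (ENNReal.ofReal (μ.prob t (σ k) (e k).1) *
      (ENNReal.ofReal (𝓜.trans t (σ k) (e k).1 (e k).2) *
        I (W (fun j => (e j).1) k) (σ k) (e k).1 (e k).2)) ≤ 1 := by
  rw [← (Equiv.arrowProdEquivProdArrow ι (fun _ => A) (fun _ => S)).symm.sum_comp,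
    Fintype.sum_prod_type]
  simp only [Equiv.arrowProdEquivProdArrow, Equiv.coe_fn_symm_mk]
  calc _ ≤ ∑ a : ι → A, ∏ k, ENNReal.ofReal (μ.prob t (σ k) (a k)) := by
        refine Finset.sum_le_sum fun a _ => ?_
        simp only [Finset.prod_mul_distrib, ← Finset.mul_sum]
        refine mul_le_of_le_one_right' ?_
        simp only [← Finset.prod_mul_distrib]
        rw [← Fintype.prod_sum fun k s' =>
          ENNReal.ofReal (𝓜.trans t (σ k) (a k) s') * I (W a k) (σ k) (a k) s']
        exact Finset.prod_le_one' fun k _ => h a k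
    _ = 1 := by
        rw [← Fintype.prod_sum fun k a => ENNReal.ofReal (μ.prob t (σ k) a)]
        refine Finset.prod_eq_one fun k _ => ?_
        rw [← ENNReal.ofReal_sum_of_nonneg fun a _ => (μ.prob_mem _ _).1 a,
          (μ.prob_mem _ _).2, ENNReal.ofReal_one]

/-- The data set with given paths in which all rewards are zero. -/
def dataOfPaths {S A : Type*} {H : ℕ} {ι : Type*} (p : ι → (Fin (H + 1) → S) × (Fin H → A)) :
    ι → Episode S A H :=
  fun k => ((p k).1, (p k).2, 0)

variable [MeasurableSpace S] [MeasurableSpace A]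
  [MeasurableSingletonClass S] [MeasurableSingletonClass A]

/-- A product over episodes and steps of nonnegative factors whose conditional means, given the
states and actions of all episodes up to the current action, are at most one, has mean at most
one. The factors may involve weights `w t k` that depend on that common past. -/
theorem lintegral_data_le_one (𝓜 : TabularMDP S A H) (μ : Policy S A H) {ι : Type*} [Fintype ι]
    (g₀ : S → ℝ≥0∞) (h₀ : ∑ s, ENNReal.ofReal (𝓜.init s) * g₀ s ≤ 1)
    (w : Fin H → ι → (ι → Episode S A H) → ℝ)
    (hw : ∀ t k D D', (∀ j, ∀ u ≤ t.castSucc, (D j).state u = (D' j).state u) →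
      (∀ j, ∀ u ≤ t, (D j).action u = (D' j).action u) → w t k D = w t k D')
    (g : Fin H → ℝ → S → A → S → ℝ → ℝ≥0∞) (hg : ∀ t x s a s', Measurable (g t x s a s'))
    (h₁ : ∀ t k D s a, ∑ s', ENNReal.ofReal (𝓜.trans t s a s') *
      ∫⁻ r, g t (w t k D) s a s' r ∂(𝓜.reward t s a s' : Measure ℝ) ≤ 1) :
    Measurable (fun D : ι → Episode S A H => (∏ k, g₀ ((D k).state 0)) *
      ∏ k, ∏ t, g t (w t k D) ((D k).state t.castSucc) ((D k).action t) ((D k).state t.succ)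
        ((D k).reward t)) ∧
    ∫⁻ D, (∏ k, g₀ ((D k).state 0)) *
      ∏ k, ∏ t, g t (w t k D) ((D k).state t.castSucc) ((D k).action t) ((D k).state t.succ)
        ((D k).reward t) ∂(Measure.pi fun _ : ι => 𝓜.episodeLaw μ) ≤ 1 := by
  classical
  have hlift : ∀ t k D, w t k D = w t k (dataOfPaths fun k => (D k).path) := fun t k D =>
    hw t k _ _ (fun _ _ _ => rfl) fun _ _ _ => rfl
  obtain ⟨hmeas, hint⟩ := 𝓜.lintegral_data μ (ι := ι)
    (fun p => ∏ k, g₀ ((p k).1 0))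
    (fun p k t r => g t (w t k (dataOfPaths p)) ((p k).1 t.castSucc) ((p k).2 t) ((p k).1 t.succ) r)
    (fun p k t => hg _ _ _ _ _)
  simp only [← hlift] at hmeas hint
  refine ⟨hmeas, hint.le.trans ?_⟩
  rw [← (pathsEquiv ι S A H).sum_comp, Fintype.sum_prod_type]
  set I : Fin H → ℝ → S → A → S → ℝ≥0∞ := fun t x s a s' =>
    ∫⁻ r, g t x s a s' r ∂(𝓜.reward t s a s' : Measure ℝ) with hI
  let Q : (ι → S) → Fin H → (Fin H → ι → A × S) → ℝ≥0∞ := fun x₀ t z => ∏ k,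
    (ENNReal.ofReal (μ.prob t (pathOf (x₀ k) (fun u => z u k) t.castSucc) (z t k).1) *
    (ENNReal.ofReal (𝓜.trans t (pathOf (x₀ k) (fun u => z u k) t.castSucc) (z t k).1 (z t k).2) *
      I t (w t k (dataOfPaths (pathsEquiv ι S A H (x₀, z))))
        (pathOf (x₀ k) (fun u => z u k) t.castSucc) (z t k).1 (z t k).2))
  have hQ : ∀ x₀, ∑ z, ∏ t, Q x₀ t z ≤ 1 := fun x₀ => by
    refine sum_prod_adapted_le_one (Q x₀) (fun t z z' h => ?_) fun t z => ?_
    · refine Finset.prod_congr rfl fun k _ => ?_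
      rw [pathOf_congr (z' := fun u => z' u k), h t le_rfl,
        hw t k _ (dataOfPaths (pathsEquiv ι S A H (x₀, z')))]
      · intro j u hu
        refine pathOf_congr _ fun v hv => ?_
        exact congrArg Prod.snd
          (congrFun (h v (Fin.castSucc_lt_castSucc_iff.1 (hv.trans_le hu)).le) j)
      · intro j u hu
        exact congrArg Prod.fst (congrFun (h u hu) j)
      · intro u hu
        rw [h u (Fin.castSucc_lt_castSucc_iff.1 hu).le]
    · refine le_of_eq_of_le (Finset.sum_congr rfl fun e _ => Finset.prod_congr rfl fun k _ => ?_)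
        (𝓜.sum_step_le_one μ t (fun k => pathOf (x₀ k) (fun u => z u k) t.castSucc)
          (fun a k => w t k (dataOfPaths (pathsEquiv ι S A H
            (x₀, Function.update z t fun k => (a k, (z t k).2)))))
          (I t) fun a k => h₁ t k _ _ _)
      rw [pathOf_congr (z' := fun u => z u k) (x₀ k), Function.update_self,
        hw t k _ (dataOfPaths (pathsEquiv ι S A H
            (x₀, Function.update z t fun k => ((e k).1, (z t k).2))))]
      · intro j u hu
        refine pathOf_congr _ fun v hv => ?_
        have : v ≠ t := (Fin.castSucc_lt_castSucc_iff.1 (hv.trans_le hu)).ne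
        simp [this]
      · intro j u hu
        rcases eq_or_ne u t with rfl | h
        · simp [dataOfPaths, pathsEquiv, Episode.action]
        · simp [dataOfPaths, pathsEquiv, Episode.action, h]
      · intro v hv
        rw [Function.update_of_ne (Fin.castSucc_lt_castSucc_iff.1 hv).ne]
  calc _ = ∑ x₀ : ι → S, (∏ k, ENNReal.ofReal (𝓜.init (x₀ k)) * g₀ (x₀ k)) *
        ∑ z : Fin H → ι → A × S, ∏ t, Q x₀ t z := by
        refine Finset.sum_congr rfl fun x₀ _ => ?_
        rw [Finset.mul_sum]
        refine Finset.sum_congr rfl fun z _ => ?_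
        simp only [Q]
        rw [Finset.prod_comm]
        simp only [pathsEquiv, Equiv.coe_fn_mk, ofReal_pathProb, pathOf_zero, pathOf_succ, hI,
          Finset.prod_mul_distrib]
        ring
    _ ≤ ∑ x₀ : ι → S, (∏ k, ENNReal.ofReal (𝓜.init (x₀ k)) * g₀ (x₀ k)) :=
        Finset.sum_le_sum fun x₀ _ => mul_le_of_le_one_right' (hQ x₀)
    _ = ∏ _k : ι, ∑ s, ENNReal.ofReal (𝓜.init s) * g₀ s :=
        (Fintype.prod_sum fun (_ : ι) s => ENNReal.ofReal (𝓜.init s) * g₀ s).symm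
    _ ≤ 1 := Finset.prod_le_one' fun _ _ => h₀

end TabularMDP

/-! ### The estimator as a sum over the episodes -/

section Estimator

variable {S A : Type*} {H : ℕ} {ι : Type*} [Fintype ι]

theorem visits_congr {D D' : ι → Episode S A H} {t : Fin H}
    (hs : ∀ k, (D k).state t.castSucc = (D' k).state t.castSucc)
    (ha : ∀ k, (D k).action t = (D' k).action t) (s : S) (a : A) :
    visits D t s a = visits D' t s a := by
  classical
  exact congrArg Finset.card (Finset.filter_congr fun k _ => by rw [hs, ha])

theorem initHat_congr {D D' : ι → Episode S A H} (hs : ∀ k, (D k).state 0 = (D' k).state 0)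
    (s : S) : initHat D s = initHat D' s := by
  classical
  exact congrArg (fun c : Finset ι => (c.card : ℝ) / Fintype.card ι)
    (Finset.filter_congr fun k _ => by rw [hs])

theorem transHat_congr {D D' : ι → Episode S A H} {t : Fin H}
    (hs : ∀ k, (D k).state t.castSucc = (D' k).state t.castSucc)
    (ha : ∀ k, (D k).action t = (D' k).action t)
    (hs' : ∀ k, (D k).state t.succ = (D' k).state t.succ) (s : S) (a : A) (s' : S) :
    transHat D t s a s' = transHat D' t s a s' := by
  classical
  rw [transHat, transHat, visits_congr hs ha]
  exact congrArg (fun c : Finset ι => (c.card : ℝ) / visits D' t s a)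
    (Finset.filter_congr fun k _ => by rw [hs, ha, hs'])

theorem transHat_nonneg (D : ι → Episode S A H) (t : Fin H) (s : S) (a : A) (s' : S) :
    0 ≤ transHat D t s a s' := by
  unfold transHat; positivity

variable [Fintype S]

open scoped Classical in
theorem sum_transHat_le_one (D : ι → Episode S A H) (t : Fin H) (s : S) (a : A) :
    ∑ s', transHat D t s a s' ≤ 1 := by
  have h : ∑ s', (Finset.univ.filter fun i => (D i).state t.castSucc = s ∧ (D i).action t = a ∧
      (D i).state t.succ = s').card = visits D t s a := by
    rw [visits, Finset.card_eq_sum_card_fiberwise (f := fun i => (D i).state t.succ)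
      (t := Finset.univ) (by simp)]
    refine Finset.sum_congr rfl fun s' _ => ?_
    rw [Finset.filter_filter]
    simp only [and_assoc]
  simp only [transHat]
  rw [← Finset.sum_div, ← Nat.cast_sum, h]
  exact div_self_le_one _

open scoped Classical in
theorem sum_initHat_mul (D : ι → Episode S A H) (f : S → ℝ) :
    ∑ s, initHat D s * f s = (∑ k, f ((D k).state 0)) / Fintype.card ι := by
  rw [← Finset.sum_fiberwise (s := Finset.univ) (g := fun k => (D k).state 0), Finset.sum_div]
  refine Finset.sum_congr rfl fun s _ => ?_
  rw [Finset.sum_congr rfl fun k hk => by rw [(Finset.mem_filter.1 hk).2], Finset.sum_const,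
    nsmul_eq_mul, initHat]
  ring

variable [Fintype A]

theorem distHat_zero (D : ι → Episode S A H) (π : Policy S A H) :
    distHat D π 0 = initHat D := rfl

theorem distHat_succ (D : ι → Episode S A H) (π : Policy S A H) (t : Fin H) (s' : S) :
    distHat D π t.succ s' = ∑ s, transPiHat D π t s s' * distHat D π t.castSucc s := by
  simp only [distHat, Fin.induction_succ]

/-- The estimated state distribution at a step depends only on the data before that step. -/
theorem distHat_congr {D D' : ι → Episode S A H} (π : Policy S A H) (t : Fin (H + 1))
    (hs : ∀ k, ∀ u ≤ t, (D k).state u = (D' k).state u)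
    (ha : ∀ k, ∀ u : Fin H, u.castSucc < t → (D k).action u = (D' k).action u) :
    distHat D π t = distHat D' π t := by
  induction t using Fin.induction with
  | zero =>
    exact funext fun s => initHat_congr (fun k => hs k 0 le_rfl) s
  | succ t ih =>
    have hlt : t.castSucc < t.succ := Fin.castSucc_lt_succ
    ext s'
    simp only [distHat_succ, transPiHat,
      transHat_congr (fun k => hs k _ hlt.le) (fun k => ha k t hlt) fun k => hs k _ le_rfl,
      ih (fun k u hu => hs k u (hu.trans hlt.le)) fun k u hu => ha k u (hu.trans hlt)]

theorem distHat_nonneg (D : ι → Episode S A H) (π : Policy S A H) (t : Fin (H + 1)) (s : S) :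
    0 ≤ distHat D π t s := by
  induction t using Fin.induction generalizing s with
  | zero => rw [distHat_zero]; unfold initHat; positivity
  | succ t ih =>
    rw [distHat_succ]
    exact Finset.sum_nonneg fun s _ => mul_nonneg (Finset.sum_nonneg fun a _ =>
      mul_nonneg (transHat_nonneg _ _ _ _ _) ((π.prob_mem _ _).1 _)) (ih s)

/-- The estimated state distributions are sub-distributions. -/
theorem sum_distHat_le_one (D : ι → Episode S A H) (π : Policy S A H) (t : Fin (H + 1)) :
    ∑ s, distHat D π t s ≤ 1 := by
  induction t using Fin.induction with
  | zero =>
    have h := sum_initHat_mul D fun _ => 1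
    simp only [mul_one, Finset.sum_const, Finset.card_univ, nsmul_eq_mul] at h
    rw [distHat_zero, h]
    exact div_self_le_one _
  | succ t ih =>
    refine le_trans ?_ ih
    simp only [distHat_succ]
    rw [Finset.sum_comm]
    refine Finset.sum_le_sum fun s _ => ?_
    rw [← Finset.sum_mul]
    refine mul_le_of_le_one_left (distHat_nonneg _ _ _ _) ?_
    simp only [transPiHat]
    rw [Finset.sum_comm, ← (π.prob_mem t s).2]
    refine Finset.sum_le_sum fun a _ => ?_
    rw [← Finset.sum_mul]
    exact mul_le_of_le_one_left ((π.prob_mem _ _).1 _) (sum_transHat_le_one _ _ _ _)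

theorem distHat_le_one (D : ι → Episode S A H) (π : Policy S A H) (t : Fin (H + 1)) (s : S) :
    distHat D π t s ≤ 1 :=
  (Finset.single_le_sum (fun s _ => distHat_nonneg D π t s) (Finset.mem_univ s)).trans
    (sum_distHat_le_one D π t)

/-- The weight in the estimator of an episode that visits `(s, a)` at step `t`: the estimated
probability of `(s, a)` under `π`, shared equally among the episodes that visit it. -/
noncomputable def visitWeight (D : ι → Episode S A H) (π : Policy S A H) (t : Fin H) (s : S)
    (a : A) : ℝ :=
  distHat D π t.castSucc s * π.prob t s a / visits D t s a

theorem visitWeight_nonneg (D : ι → Episode S A H) (π : Policy S A H) (t : Fin H) (s : S)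
    (a : A) : 0 ≤ visitWeight D π t s a :=
  div_nonneg (mul_nonneg (distHat_nonneg _ _ _ _) ((π.prob_mem _ _).1 _)) (Nat.cast_nonneg _)

theorem visitWeight_le (D : ι → Episode S A H) (π : Policy S A H) (t : Fin H) (s : S) (a : A)
    {τ : ℝ} (hτ : 0 < τ) (h : τ ≤ visits D t s a) : visitWeight D π t s a ≤ 1 / τ := by
  refine div_le_div₀ zero_le_one ?_ hτ h
  refine mul_le_one₀ (distHat_le_one _ _ _ _) ((π.prob_mem _ _).1 _) ?_
  rw [← (π.prob_mem t s).2]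
  exact Finset.single_le_sum (fun a _ => (π.prob_mem t s).1 a) (Finset.mem_univ a)

theorem visitWeight_congr {D D' : ι → Episode S A H} (π : Policy S A H) {t : Fin H}
    (hs : ∀ k, ∀ u ≤ t.castSucc, (D k).state u = (D' k).state u)
    (ha : ∀ k, ∀ u ≤ t, (D k).action u = (D' k).action u) (s : S) (a : A) :
    visitWeight D π t s a = visitWeight D' π t s a := by
  rw [visitWeight, visitWeight, visits_congr (fun k => hs k _ le_rfl) (fun k => ha k _ le_rfl),
    distHat_congr π _ hs fun k u hu => ha k u (Fin.castSucc_lt_castSucc_iff.1 hu).le]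

/-- The weight of episode `k` at step `t`. -/
noncomputable def episodeWeight (D : ι → Episode S A H) (π : Policy S A H) (t : Fin H) (k : ι) :
    ℝ :=
  visitWeight D π t ((D k).state t.castSucc) ((D k).action t)

open scoped Classical in
theorem sum_visit {D : ι → Episode S A H} (t : Fin H) (G : S → A → ℝ) (F : ι → ℝ) :
    ∑ k, G ((D k).state t.castSucc) ((D k).action t) * F k = ∑ s, ∑ a, G s a *
      ∑ k, if (D k).state t.castSucc = s ∧ (D k).action t = a then F k else 0 := by
  simp only [Finset.mul_sum]
  rw [Finset.sum_congr rfl fun s _ => Finset.sum_comm, Finset.sum_comm]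
  refine Finset.sum_congr rfl fun k _ => ?_
  rw [Finset.sum_eq_single ((D k).state t.castSucc), Finset.sum_eq_single ((D k).action t)]
  · simp
  · intro a _ ha
    simp [ha.symm]
  · simp
  · intro s _ hs
    simp [hs.symm]
  · simp

theorem sum_episodeWeight_reward (D : ι → Episode S A H) (π : Policy S A H) (t : Fin H) :
    ∑ k, episodeWeight D π t k * (D k).reward t =
      ∑ s, distHat D π t.castSucc s * rewardPiHat D π t s := by
  simp only [episodeWeight]
  rw [sum_visit t (visitWeight D π t) fun k => (D k).reward t]
  refine Finset.sum_congr rfl fun s _ => ?_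
  simp only [rewardPiHat, rewardHat, visitWeight, Finset.mul_sum]
  refine Finset.sum_congr rfl fun a _ => ?_
  rw [← Finset.mul_sum]
  ring

open scoped Classical in
theorem sum_episodeWeight_next (D : ι → Episode S A H) (π : Policy S A H) (t : Fin H)
    (V : S → ℝ) :
    ∑ k, episodeWeight D π t k * V ((D k).state t.succ) =
      ∑ s, distHat D π t.succ s * V s := by
  have h : ∀ s a, (∑ k, if (D k).state t.castSucc = s ∧ (D k).action t = a then
      V ((D k).state t.succ) else 0) / visits D t s a = ∑ s', transHat D t s a s' * V s' := by
    intro s a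
    rw [← Finset.sum_fiberwise (s := Finset.univ) (g := fun k => (D k).state t.succ),
      Finset.sum_div]
    refine Finset.sum_congr rfl fun s' _ => ?_
    rw [← Finset.sum_filter, Finset.filter_filter,
      Finset.sum_congr (g := fun _ => V s') rfl
        fun k hk => by rw [(Finset.mem_filter.1 hk).2.1],
      Finset.sum_const, nsmul_eq_mul, transHat]
    have : (Finset.univ.filter fun k => (D k).state t.succ = s' ∧
        (D k).state t.castSucc = s ∧ (D k).action t = a) = Finset.univ.filter fun k =>
        (D k).state t.castSucc = s ∧ (D k).action t = a ∧ (D k).state t.succ = s' := by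
      ext k; simp only [Finset.mem_filter]; tauto
    rw [this]
    ring
  simp only [episodeWeight]
  rw [sum_visit t (visitWeight D π t) fun k => V ((D k).state t.succ)]
  simp only [distHat_succ, transPiHat, Finset.sum_mul]
  conv_rhs => rw [Finset.sum_comm]
  refine Finset.sum_congr rfl fun s _ => ?_
  conv_rhs => rw [Finset.sum_comm]
  refine Finset.sum_congr rfl fun a _ => ?_
  calc _ = distHat D π t.castSucc s * π.prob t s a * ((∑ k, if (D k).state t.castSucc = s ∧
        (D k).action t = a then V ((D k).state t.succ) else 0) / visits D t s a) := by
        rw [visitWeight]; ring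
    _ = _ := by
      rw [h, Finset.mul_sum]
      exact Finset.sum_congr rfl fun s' _ => by ring

theorem sum_episodeWeight_visit (D : ι → Episode S A H) (π : Policy S A H) (t : Fin H)
    (hv : ∀ s a, visits D t s a ≠ 0) (f : S → A → ℝ) :
    ∑ k, episodeWeight D π t k * f ((D k).state t.castSucc) ((D k).action t) =
      ∑ s, distHat D π t.castSucc s * ∑ a, π.prob t s a * f s a := by
  classical
  have h := sum_visit (D := D) t (fun s a => visitWeight D π t s a * f s a) fun _ => 1
  simp only [mul_one] at h
  simp only [episodeWeight]
  rw [h]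
  refine Finset.sum_congr rfl fun s _ => ?_
  rw [Finset.mul_sum]
  refine Finset.sum_congr rfl fun a _ => ?_
  have h2 : (∑ k, if (D k).state t.castSucc = s ∧ (D k).action t = a then (1 : ℝ) else 0) =
      visits D t s a := by
    rw [Finset.sum_boole, visits]
  have h3 : (visits D t s a : ℝ) ≠ 0 := Nat.cast_ne_zero.2 (hv s a)
  rw [h2, visitWeight]
  field_simp

end Estimator

/-! ### The error of the estimator -/

namespace TabularMDP

variable {S A : Type*} [Fintype S] [Fintype A] {H : ℕ}

/-- The variance of the one-step return. -/
noncomputable def returnVar (𝓜 : TabularMDP S A H) (π : Policy S A H) (t : Fin H) (s : S)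
    (a : A) : ℝ :=
  𝓜.returnSq π t s a - 𝓜.actionValue π t s a ^ 2

/-- The one-step return observed in an episode. -/
noncomputable def observedReturn (𝓜 : TabularMDP S A H) (π : Policy S A H) (t : Fin H)
    (ω : Episode S A H) : ℝ :=
  ω.reward t + 𝓜.stateValue π t.succ (ω.state t.succ)

/-- The deviation of the observed one-step return from its conditional mean. -/
noncomputable def returnDev (𝓜 : TabularMDP S A H) (π : Policy S A H) (t : Fin H)
    (ω : Episode S A H) : ℝ :=
  𝓜.observedReturn π t ω - 𝓜.actionValue π t (ω.state t.castSucc) (ω.action t)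

/-- The deviation of the square of the observed one-step return from its conditional mean. -/
noncomputable def returnSqDev (𝓜 : TabularMDP S A H) (π : Policy S A H) (t : Fin H)
    (ω : Episode S A H) : ℝ :=
  𝓜.observedReturn π t ω ^ 2 - 𝓜.returnSq π t (ω.state t.castSucc) (ω.action t)

variable {ι : Type*} [Fintype ι]

/-- The simulation lemma: the error of the estimator is the sum of the deviations of the observed
one-step returns, weighted by the estimated occupation of `π`. -/
theorem tmis_sub_eq (𝓜 : TabularMDP S A H) (D : ι → Episode S A H) (π : Policy S A H)
    (hv : ∀ t s a, visits D t s a ≠ 0) :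
    tmis D π = (∑ k, 𝓜.stateValue π 0 ((D k).state 0)) / Fintype.card ι +
      ∑ t, ∑ k, episodeWeight D π t k * 𝓜.returnDev π t (D k) := by
  have h : ∀ t : Fin H, ∑ k, episodeWeight D π t k * 𝓜.returnDev π t (D k) =
      ∑ s, distHat D π t.castSucc s * rewardPiHat D π t s +
        (∑ s, distHat D π t.succ s * 𝓜.stateValue π t.succ s -
          ∑ s, distHat D π t.castSucc s * 𝓜.stateValue π t.castSucc s) := fun t => by
    simp only [returnDev, observedReturn, mul_sub, mul_add, Finset.sum_sub_distrib,
      Finset.sum_add_distrib, stateValue_castSucc]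
    rw [sum_episodeWeight_reward, sum_episodeWeight_next,
      sum_episodeWeight_visit D π t (hv t) (𝓜.actionValue π t)]
    ring
  simp only [h, Finset.sum_add_distrib]
  rw [sum_succ_sub_castSucc fun t => ∑ s, distHat D π t s * 𝓜.stateValue π t s, tmis,
    distHat_zero, sum_initHat_mul]
  simp [stateValue_last]

/-- Along the estimated chain the conditional variances of the one-step returns add up to at most
twice the square of the maximal return, up to the deviations of the squared returns: the squares
of the values telescope. -/
theorem sum_returnSqDev_le (𝓜 : TabularMDP S A H) (D : ι → Episode S A H) (π : Policy S A H)
    (hv : ∀ t s a, visits D t s a ≠ 0) {R : ℝ} (hR0 : 0 ≤ R) (hR : 𝓜.RewardsBounded R)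
    (hD : ∀ t k, (D k).reward t ∈ Set.Icc 0 R) :
    ∑ t, ∑ k, episodeWeight D π t k * 𝓜.returnSqDev π t (D k) ≤
      2 * (H * R) ^ 2 - ∑ t, ∑ k, episodeWeight D π t k *
        𝓜.returnVar π t ((D k).state t.castSucc) ((D k).action t) := by
  set U : Fin (H + 1) → ℝ := fun t => ∑ s, distHat D π t s * 𝓜.stateValue π t s ^ 2 with hU
  have hw : ∀ t k, 0 ≤ episodeWeight D π t k := fun t k => visitWeight_nonneg _ _ _ _ _
  have h : ∀ t : Fin H, ∑ k, episodeWeight D π t k * 𝓜.returnSqDev π t (D k) ≤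
      2 * (H * R) * R + (U t.succ - U t.castSucc) - ∑ k, episodeWeight D π t k *
        𝓜.returnVar π t ((D k).state t.castSucc) ((D k).action t) := fun t => by
    have h1 : ∑ k, episodeWeight D π t k * 𝓜.observedReturn π t (D k) ^ 2 ≤
        2 * (H * R) * R + U t.succ := by
      have hw1 : ∑ k, episodeWeight D π t k ≤ 1 := by
        have := sum_episodeWeight_next D π t fun _ => 1
        simp only [mul_one] at this
        exact this.trans_le (sum_distHat_le_one D π _)
      calc _ ≤ ∑ k, (episodeWeight D π t k * (2 * (H * R) * R) +
            episodeWeight D π t k * 𝓜.stateValue π t.succ ((D k).state t.succ) ^ 2) := by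
            refine Finset.sum_le_sum fun k _ => ?_
            rw [← mul_add]
            refine mul_le_mul_of_nonneg_left ?_ (hw t k)
            have h2 := 𝓜.reward_add_stateValue_mem π hR0 hR t ((D k).state t.succ) (hD t k)
            have h3 := 𝓜.stateValue_mem' π hR0 hR t.succ ((D k).state t.succ)
            have h4 := hD t k
            have h5 : 0 ≤ H * R := h3.1.trans h3.2
            rw [observedReturn]
            -- `(r + V) ^ 2 ≤ V ^ 2 + 2 * r * (r + V)`
            nlinarith [mul_nonneg h4.1 (sub_nonneg.2 h2.2), mul_nonneg h5 (sub_nonneg.2 h4.2),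
              mul_nonneg h4.1 h4.1]
        _ ≤ _ := by
            rw [Finset.sum_add_distrib, ← Finset.sum_mul,
              sum_episodeWeight_next D π t fun s => 𝓜.stateValue π t.succ s ^ 2]
            exact add_le_add_left (mul_le_of_le_one_left (by positivity) hw1) _
    have h2 : U t.castSucc ≤ ∑ k, episodeWeight D π t k *
        𝓜.actionValue π t ((D k).state t.castSucc) ((D k).action t) ^ 2 := by
      rw [sum_episodeWeight_visit D π t (hv t) fun s a => 𝓜.actionValue π t s a ^ 2]
      refine Finset.sum_le_sum fun s _ => mul_le_mul_of_nonneg_left ?_ (distHat_nonneg _ _ _ _)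
      rw [stateValue_castSucc]
      -- Jensen's inequality for the average over the actions
      exact (even_two.convexOn_pow (𝕜 := ℝ)).map_sum_le (fun a _ => (π.prob_mem t s).1 a)
        (π.prob_mem t s).2 fun a _ => Set.mem_univ _
    have h3 : ∀ k, episodeWeight D π t k * 𝓜.returnSqDev π t (D k) =
        episodeWeight D π t k * 𝓜.observedReturn π t (D k) ^ 2 -
        episodeWeight D π t k *
          𝓜.actionValue π t ((D k).state t.castSucc) ((D k).action t) ^ 2 -
        episodeWeight D π t k *
          𝓜.returnVar π t ((D k).state t.castSucc) ((D k).action t) := fun k => by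
      rw [returnSqDev, returnVar]; ring
    simp only [h3, Finset.sum_sub_distrib]
    linarith
  refine (Finset.sum_le_sum fun t _ => h t).trans ?_
  rw [Finset.sum_sub_distrib, Finset.sum_add_distrib, sum_succ_sub_castSucc]
  have h4 : U (Fin.last H) = 0 := by simp [hU, stateValue_last]
  have h5 : 0 ≤ U 0 :=
    Finset.sum_nonneg fun s _ => mul_nonneg (distHat_nonneg _ _ _ _) (sq_nonneg _)
  simp only [Finset.sum_const, Finset.card_univ, Fintype.card_fin, nsmul_eq_mul]
  nlinarith

/-- The logarithm of the factor that one step of one episode contributes to the exponential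
supermartingale; `x` is the weight of the episode. -/
noncomputable def stepExponent (𝓜 : TabularMDP S A H) (π : Policy S A H) (B θ φ : ℝ) (t : Fin H)
    (x : ℝ) (ω : Episode S A H) : ℝ :=
  x * (θ * 𝓜.returnDev π t ω - φ * 𝓜.returnSqDev π t ω) -
    x ^ 2 * (2 * θ ^ 2 + 8 * φ ^ 2 * B ^ 2) *
      𝓜.returnVar π t (ω.state t.castSucc) (ω.action t)

theorem returnVar_nonneg (𝓜 : TabularMDP S A H) (π : Policy S A H) {R : ℝ} (hR0 : 0 ≤ R)
    (hR : 𝓜.RewardsBounded R) (t : Fin H) (s : S) (a : A) : 0 ≤ 𝓜.returnVar π t s a := by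
  have h := ProbabilityTheory.variance_eq_sub (X := fun x : ℝ => x)
    (memLp_of_bounded (𝓜.ae_returnLaw_mem π hR0 hR t s a) (by fun_prop) 2)
  have h0 := ProbabilityTheory.variance_nonneg (fun x : ℝ => x) (𝓜.returnLaw π t s a)
  rwa [h] at h0

/-- The error of the estimator is bounded by the exponent of the supermartingale. The quadratic
terms cancel because the coefficient `φ` of the squared returns dominates the variance proxy. -/
theorem mul_tmis_sub_le (𝓜 : TabularMDP S A H) (D : ι → Episode S A H) (π : Policy S A H)
    (hv : ∀ t s a, visits D t s a ≠ 0) {R : ℝ} (hR0 : 0 ≤ R) (hR : 𝓜.RewardsBounded R)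
    (hD : ∀ t k, (D k).reward t ∈ Set.Icc 0 R) {α θ φ : ℝ} (hφ0 : 0 ≤ φ)
    (hα : ∀ t k, episodeWeight D π t k ≤ α)
    (hφ : α * (2 * θ ^ 2 + 8 * φ ^ 2 * (H * R) ^ 2) ≤ φ) :
    θ * (tmis D π - (∑ k, 𝓜.stateValue π 0 ((D k).state 0)) / Fintype.card ι) ≤
      ∑ k, ∑ t, 𝓜.stepExponent π (H * R) θ φ t (episodeWeight D π t k) (D k) +
        2 * φ * (H * R) ^ 2 := by
  have hw : ∀ t k, 0 ≤ episodeWeight D π t k := fun t k => visitWeight_nonneg _ _ _ _ _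
  have h1 := mul_le_mul_of_nonneg_left (𝓜.sum_returnSqDev_le D π hv hR0 hR hD) hφ0
  set c := 2 * θ ^ 2 + 8 * φ ^ 2 * (H * R) ^ 2 with hc
  have hc0 : 0 ≤ c := by positivity
  have h2 : ∑ t, ∑ k, episodeWeight D π t k ^ 2 * c *
      𝓜.returnVar π t ((D k).state t.castSucc) ((D k).action t) ≤
      φ * ∑ t, ∑ k, episodeWeight D π t k *
        𝓜.returnVar π t ((D k).state t.castSucc) ((D k).action t) := by
    simp only [Finset.mul_sum]
    refine Finset.sum_le_sum fun t _ => Finset.sum_le_sum fun k _ => ?_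
    rw [← mul_assoc]
    refine mul_le_mul_of_nonneg_right ?_ (𝓜.returnVar_nonneg π hR0 hR _ _ _)
    have := mul_le_mul_of_nonneg_right (hα t k) hc0
    nlinarith [hw t k]
  have h3 : ∑ k, ∑ t, 𝓜.stepExponent π (H * R) θ φ t (episodeWeight D π t k) (D k) =
      θ * (∑ t, ∑ k, episodeWeight D π t k * 𝓜.returnDev π t (D k)) -
      φ * (∑ t, ∑ k, episodeWeight D π t k * 𝓜.returnSqDev π t (D k)) -
      ∑ t, ∑ k, episodeWeight D π t k ^ 2 * c *
        𝓜.returnVar π t ((D k).state t.castSucc) ((D k).action t) := by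
    rw [Finset.sum_comm]
    simp only [Finset.mul_sum, ← Finset.sum_sub_distrib]
    refine Finset.sum_congr rfl fun t _ => Finset.sum_congr rfl fun k _ => ?_
    rw [stepExponent]
    ring
  rw [𝓜.tmis_sub_eq D π hv, add_sub_cancel_left, h3]
  linarith

end TabularMDP

/-! ### Concentration for the folds -/

/-- The episodes of the `i`-th fold. -/
def fold {S A : Type*} {H n M N : ℕ} (e : Fin N × Fin M ≃ Fin n) (D : Fin n → Episode S A H)
    (i : Fin N) : Fin M → Episode S A H :=
  fun j => D (e (i, j))

theorem sum_folds {n M N : ℕ} (e : Fin N × Fin M ≃ Fin n) (f : Fin n → ℝ) :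
    ∑ k, f k = ∑ i, ∑ j, f (e (i, j)) := by
  rw [← e.sum_comp, Fintype.sum_prod_type]

open scoped Classical in
/-- The weight of episode `k` within its fold, set to zero if the state-action pair that it visits
at step `t` is visited by fewer than `τ` episodes of the fold. -/
noncomputable def truncWeight {S A : Type*} [Fintype S] [Fintype A] {H n M N : ℕ}
    (e : Fin N × Fin M ≃ Fin n) (π : Policy S A H) (τ : ℝ) (t : Fin H) (k : Fin n)
    (D : Fin n → Episode S A H) : ℝ :=
  if τ ≤ visits (fold e D (e.symm k).1) t ((D k).state t.castSucc) ((D k).action t) then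
    visitWeight (fold e D (e.symm k).1) π t ((D k).state t.castSucc) ((D k).action t) else 0

theorem truncWeight_mem {S A : Type*} [Fintype S] [Fintype A] {H n M N : ℕ}
    (e : Fin N × Fin M ≃ Fin n) (π : Policy S A H) {τ : ℝ} (hτ : 0 < τ) (t : Fin H) (k : Fin n)
    (D : Fin n → Episode S A H) : truncWeight e π τ t k D ∈ Set.Icc 0 (1 / τ) := by
  rw [truncWeight]
  split_ifs with h
  · exact ⟨visitWeight_nonneg _ _ _ _ _, visitWeight_le _ _ _ _ _ hτ h⟩
  · exact ⟨le_rfl, by positivity⟩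

theorem truncWeight_congr {S A : Type*} [Fintype S] [Fintype A] {H n M N : ℕ}
    (e : Fin N × Fin M ≃ Fin n) (π : Policy S A H) (τ : ℝ) (t : Fin H) (k : Fin n)
    (D D' : Fin n → Episode S A H)
    (hs : ∀ j, ∀ u ≤ t.castSucc, (D j).state u = (D' j).state u)
    (ha : ∀ j, ∀ u ≤ t, (D j).action u = (D' j).action u) :
    truncWeight e π τ t k D = truncWeight e π τ t k D' := by
  have h1 := visits_congr (D := fold e D (e.symm k).1) (D' := fold e D' (e.symm k).1) (t := t)
    (fun j => hs _ _ le_rfl) (fun j => ha _ _ le_rfl)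
  have h2 := visitWeight_congr (D := fold e D (e.symm k).1) (D' := fold e D' (e.symm k).1) π
    (t := t) (fun j => hs _) (fun j => ha _)
  rw [truncWeight, truncWeight, h1, h2, hs k _ le_rfl, ha k _ le_rfl]

theorem truncWeight_eq {S A : Type*} [Fintype S] [Fintype A] {H n M N : ℕ}
    (e : Fin N × Fin M ≃ Fin n) (π : Policy S A H) {τ : ℝ} (t : Fin H)
    (D : Fin n → Episode S A H) (i : Fin N) (j : Fin M)
    (h : ∀ s a, τ ≤ visits (fold e D i) t s a) :
    truncWeight e π τ t (e (i, j)) D = episodeWeight (fold e D i) π t j := by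
  rw [truncWeight, e.symm_apply_apply, if_pos (h _ _)]
  rfl

namespace TabularMDP

variable {S A : Type*} [Fintype S] {H n M N : ℕ}

/-- The exponential moment of the value of the initial state (Hoeffding's bound). -/
theorem sum_init_mul_exp_le_one (𝓜 : TabularMDP S A H) (V : S → ℝ) {B x : ℝ}
    (hV : ∀ s, V s ∈ Set.Icc 0 B) (hx : |x| * B ≤ 1) :
    ∑ s, ENNReal.ofReal (𝓜.init s) * ENNReal.ofReal (Real.exp
      (x * (V s - ∑ s', 𝓜.init s' * V s') - x ^ 2 * B ^ 2)) ≤ 1 := by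
  generalize hvdef : ∑ s', 𝓜.init s' * V s' = v
  have hv : v ∈ Set.Icc 0 B := by
    refine ⟨hvdef ▸ Finset.sum_nonneg fun s _ => mul_nonneg (𝓜.init_mem.1 s) (hV s).1, ?_⟩
    rw [← hvdef]
    calc ∑ s, 𝓜.init s * V s ≤ ∑ s, 𝓜.init s * B := Finset.sum_le_sum fun s _ =>
          mul_le_mul_of_nonneg_left (hV s).2 (𝓜.init_mem.1 s)
      _ = B := by rw [← Finset.sum_mul, 𝓜.init_mem.2, one_mul]
  have hle : ∀ s, Real.exp (x * (V s - v) - x ^ 2 * B ^ 2) ≤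
      (1 + x ^ 2 * B ^ 2 + x * (V s - v)) * Real.exp (-(x ^ 2 * B ^ 2)) := fun s => by
    have h1 : |V s - v| ≤ B := abs_sub_le_of_nonneg_of_le (hV s).1 (hV s).2 hv.1 hv.2
    have h2 : |x * (V s - v)| ≤ 1 := by
      rw [abs_mul]
      exact (mul_le_mul_of_nonneg_left h1 (abs_nonneg x)).trans hx
    have h3 := (abs_le.1 (Real.abs_exp_sub_one_sub_id_le h2)).2
    have h4 : (x * (V s - v)) ^ 2 ≤ x ^ 2 * B ^ 2 := by
      rw [mul_pow]
      exact mul_le_mul_of_nonneg_left (sq_le_sq' (abs_le.1 h1).1 (abs_le.1 h1).2) (sq_nonneg x)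
    rw [sub_eq_add_neg _ (x ^ 2 * B ^ 2), Real.exp_add]
    gcongr
    linarith
  simp only [← ENNReal.ofReal_mul (𝓜.init_mem.1 _)]
  rw [← ENNReal.ofReal_sum_of_nonneg fun s _ => mul_nonneg (𝓜.init_mem.1 s) (Real.exp_pos _).le,
    ← ENNReal.ofReal_one]
  refine ENNReal.ofReal_le_ofReal ?_
  calc _ ≤ ∑ s, 𝓜.init s * ((1 + x ^ 2 * B ^ 2 + x * (V s - v)) *
        Real.exp (-(x ^ 2 * B ^ 2))) := Finset.sum_le_sum fun s _ =>
          mul_le_mul_of_nonneg_left (hle s) (𝓜.init_mem.1 s)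
    _ = ((1 + x ^ 2 * B ^ 2 - x * v) * ∑ s, 𝓜.init s + x * ∑ s, 𝓜.init s * V s) *
        Real.exp (-(x ^ 2 * B ^ 2)) := by
      rw [Finset.mul_sum, Finset.mul_sum, ← Finset.sum_add_distrib, Finset.sum_mul]
      exact Finset.sum_congr rfl fun s _ => by ring
    _ = (x ^ 2 * B ^ 2 + 1) * Real.exp (-(x ^ 2 * B ^ 2)) := by
      rw [𝓜.init_mem.2, hvdef]; ring
    _ ≤ 1 := by
      rw [Real.exp_neg, ← div_eq_mul_inv, div_le_one (Real.exp_pos _)]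
      exact Real.add_one_le_exp _

variable [Fintype A]

/-- The exponent of the supermartingale over all episodes and all steps. -/
noncomputable def dataExponent (𝓜 : TabularMDP S A H) (π : Policy S A H)
    (e : Fin N × Fin M ≃ Fin n) (τ B θ φ : ℝ) (D : Fin n → Episode S A H) : ℝ :=
  ∑ k, (θ / M * (𝓜.stateValue π 0 ((D k).state 0) - ∑ s, 𝓜.init s * 𝓜.stateValue π 0 s) -
    (θ / M) ^ 2 * B ^ 2) +
  ∑ k, ∑ t, 𝓜.stepExponent π B θ φ t (truncWeight e π τ t k D) (D k)

variable [MeasurableSpace S] [MeasurableSpace A]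
  [MeasurableSingletonClass S] [MeasurableSingletonClass A]

theorem measure_dataExponent_ge_le (𝓜 : TabularMDP S A H) (μ π : Policy S A H)
    (e : Fin N × Fin M ≃ Fin n) {R : ℝ} (hR0 : 0 ≤ R) (hR : 𝓜.RewardsBounded R) {τ θ φ : ℝ}
    (hτ : 0 < τ) (hφ : 0 ≤ φ) (hθ : |θ / M| * (H * R) ≤ 1)
    (hB : 1 / τ * (|θ| * (H * R) + φ * (H * R) ^ 2) ≤ 1) (l : ℝ) :
    (Measure.pi fun _ : Fin n => 𝓜.episodeLaw μ)
      {D | l ≤ 𝓜.dataExponent π e τ (H * R) θ φ D} ≤ ENNReal.ofReal (Real.exp (-l)) := by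
  set B := H * R with hBdef
  have hB0 : 0 ≤ B := by positivity
  obtain ⟨hmeas, hint⟩ := 𝓜.lintegral_data_le_one μ (ι := Fin n)
    (fun s => ENNReal.ofReal (Real.exp (θ / M * (𝓜.stateValue π 0 s -
      ∑ s, 𝓜.init s * 𝓜.stateValue π 0 s) - (θ / M) ^ 2 * B ^ 2)))
    (𝓜.sum_init_mul_exp_le_one _ (𝓜.stateValue_mem' π hR0 hR 0) hθ)
    (truncWeight e π τ) (truncWeight_congr e π τ)
    (fun t x s a s' r => ENNReal.ofReal (Real.exp
      (x * (θ * (r + 𝓜.stateValue π t.succ s' - 𝓜.actionValue π t s a) -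
        φ * ((r + 𝓜.stateValue π t.succ s') ^ 2 - 𝓜.returnSq π t s a)) -
      x ^ 2 * (2 * θ ^ 2 + 8 * φ ^ 2 * B ^ 2) * 𝓜.returnVar π t s a)))
    (fun t x s a s' => by fun_prop)
    (fun t k D s a => by
      have hw := truncWeight_mem e π hτ t k D
      refine le_of_eq_of_le (𝓜.lintegral_bootstrapLaw (𝓜.stateValue π t.succ) t s a
        (fun y => ENNReal.ofReal (Real.exp (truncWeight e π τ t k D *
          (θ * (y - 𝓜.actionValue π t s a) - φ * (y ^ 2 - 𝓜.returnSq π t s a)) -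
          truncWeight e π τ t k D ^ 2 * (2 * θ ^ 2 + 8 * φ ^ 2 * B ^ 2) *
            𝓜.returnVar π t s a))) (by fun_prop)).symm ?_
      refine lintegral_exp_centred_le_one (𝓜.ae_returnLaw_mem π hR0 hR t s a) hw.1 hφ ?_ rfl rfl
      exact (mul_le_mul_of_nonneg_right hw.2 (by positivity)).trans hB)
  have hF : ∀ D : Fin n → Episode S A H,
      ENNReal.ofReal (Real.exp (𝓜.dataExponent π e τ B θ φ D)) =
      (∏ k, ENNReal.ofReal (Real.exp (θ / M * (𝓜.stateValue π 0 ((D k).state 0) -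
        ∑ s, 𝓜.init s * 𝓜.stateValue π 0 s) - (θ / M) ^ 2 * B ^ 2))) *
      ∏ k, ∏ t, ENNReal.ofReal (Real.exp
        (𝓜.stepExponent π B θ φ t (truncWeight e π τ t k D) (D k))) := fun D => by
    rw [dataExponent, Real.exp_add, Real.exp_sum, Real.exp_sum,
      ENNReal.ofReal_mul (by positivity), ENNReal.ofReal_prod_of_nonneg fun _ _ => by positivity,
      ENNReal.ofReal_prod_of_nonneg fun _ _ => by positivity]
    simp only [Real.exp_sum, ENNReal.ofReal_prod_of_nonneg fun _ _ => (Real.exp_pos _).le]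
  have hmeas' : Measurable fun D : Fin n → Episode S A H =>
      ENNReal.ofReal (Real.exp (𝓜.dataExponent π e τ B θ φ D)) := by
    simp only [hF]; exact hmeas
  have hint' : ∫⁻ D, ENNReal.ofReal (Real.exp (𝓜.dataExponent π e τ B θ φ D))
      ∂(Measure.pi fun _ : Fin n => 𝓜.episodeLaw μ) ≤ 1 := by
    simp only [hF]; exact hint
  have h := (mul_meas_ge_le_lintegral hmeas' (ENNReal.ofReal (Real.exp l))).trans hint'
  simp only [ENNReal.ofReal_le_ofReal_iff (Real.exp_pos _).le, Real.exp_le_exp] at h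
  rw [Real.exp_neg, ENNReal.ofReal_inv_of_pos (Real.exp_pos _)]
  rw [mul_comm] at h
  exact (ENNReal.le_inv_iff_mul_le).2 h

/-- Chernoff's bound for the number of visits in a fold. -/
theorem measure_visits_lt_le (𝓜 : TabularMDP S A H) (μ : Policy S A H)
    (e : Fin N × Fin M ≃ Fin n) (i : Fin N) (t : Fin H) (s : S) (a : A) (τ : ℝ) :
    (Measure.pi fun _ : Fin n => 𝓜.episodeLaw μ)
      {D | (visits (fold e D i) t s a : ℝ) ≤ τ} ≤
      ENNReal.ofReal (Real.exp (τ - M * 𝓜.stateActionDist μ t s a / 2)) := by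
  classical
  let E : Set (Episode S A H) := {ω | ω.state t.castSucc = s ∧ ω.action t = a}
  have hE : MeasurableSet E := by
    have h1 : Measurable fun ω : Episode S A H => ω.state t.castSucc := by
      unfold Episode.state; fun_prop
    have h2 : Measurable fun ω : Episode S A H => ω.action t := by
      unfold Episode.action; fun_prop
    exact (h1 (measurableSet_singleton s)).inter (h2 (measurableSet_singleton a))
  set p := 𝓜.stateActionDist μ t s a with hp
  let f : Episode S A H → ℝ≥0∞ := fun ω => ENNReal.ofReal (Real.exp (if ω ∈ E then -1 else 0))
  have hf : Measurable f :=
    (Real.measurable_exp.comp (Measurable.ite hE measurable_const measurable_const)).ennreal_ofReal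
  have hfint : ∫⁻ ω, f ω ∂𝓜.episodeLaw μ ≤ ENNReal.ofReal (Real.exp (-(p / 2))) := by
    have hp1 : 𝓜.episodeLaw μ E = ENNReal.ofReal p := (ofReal_measureReal (by simp)).symm
    have hp0 : 0 ≤ p := measureReal_nonneg
    have hple : p ≤ 1 := measureReal_le_one
    have hfE : f = fun ω => E.indicator (fun _ => ENNReal.ofReal (Real.exp (-1))) ω +
        Eᶜ.indicator (fun _ => 1) ω := by
      ext ω
      by_cases hω : ω ∈ E <;> simp [f, hω]
    rw [hfE, lintegral_add_left (measurable_const.indicator hE), lintegral_indicator_const hE,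
      lintegral_indicator_const hE.compl, prob_compl_eq_one_sub hE, hp1, one_mul,
      ← ENNReal.ofReal_one, ← ENNReal.ofReal_sub _ hp0, ← ENNReal.ofReal_mul (by positivity),
      ← ENNReal.ofReal_add (by positivity) (by linarith)]
    refine ENNReal.ofReal_le_ofReal ?_
    have h1 : Real.exp (-1) ≤ 1 / 2 := by
      rw [Real.exp_neg, ← one_div]
      exact one_div_le_one_div_of_le two_pos (by linarith [Real.add_one_le_exp 1])
    nlinarith [Real.add_one_le_exp (-(p / 2))]
  let g : Fin n → Episode S A H → ℝ≥0∞ := fun k ω => if (e.symm k).1 = i then f ω else 1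
  have hg : ∀ k, Measurable (g k) := fun k => by
    simp only [g]; split_ifs
    · exact hf
    · exact measurable_const
  have hprod : ∀ D : Fin n → Episode S A H,
      ∏ k, g k (D k) = ENNReal.ofReal (Real.exp (-(visits (fold e D i) t s a : ℝ))) := fun D => by
    rw [← e.prod_comp, Fintype.prod_prod_type, Finset.prod_eq_single i]
    · simp only [g, e.symm_apply_apply, if_true, f]
      rw [← ENNReal.ofReal_prod_of_nonneg fun _ _ => (Real.exp_pos _).le, ← Real.exp_sum]
      have hcard : (visits (fold e D i) t s a : ℝ) = ∑ j, if D (e (i, j)) ∈ E then 1 else 0 := by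
        rw [Finset.sum_boole, visits]
        congr!
      rw [hcard, ← Finset.sum_neg_distrib]
      congr 2
      exact Finset.sum_congr rfl fun j _ => by split_ifs <;> simp
    · intro b _ hb
      simp [g, hb]
    · simp
  have hint : ∫⁻ D, ∏ k, g k (D k) ∂(Measure.pi fun _ : Fin n => 𝓜.episodeLaw μ) ≤
      ENNReal.ofReal (Real.exp (-(M * p / 2))) := by
    rw [lintegral_pi_prod _ g hg, ← e.prod_comp, Fintype.prod_prod_type, Finset.prod_eq_single i]
    · simp only [g, e.symm_apply_apply, if_true]
      refine (Finset.prod_le_prod' fun _ _ => hfint).trans (le_of_eq ?_)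
      rw [Finset.prod_const, ← ENNReal.ofReal_pow (Real.exp_pos _).le, ← Real.exp_nat_mul,
        Finset.card_univ, Fintype.card_fin]
      congr 2
      ring
    · intro b _ hb
      simp [g, hb]
    · simp
  have h := (mul_meas_ge_le_lintegral (Finset.measurable_prod _ fun k _ =>
    (hg k).comp (measurable_pi_apply k)) (ENNReal.ofReal (Real.exp (-τ)))).trans hint
  simp only [Function.comp_apply, hprod] at h
  simp only [ENNReal.ofReal_le_ofReal_iff (Real.exp_pos _).le, Real.exp_le_exp, neg_le_neg_iff] at h
  have h2 := mul_le_mul_right h (ENNReal.ofReal (Real.exp τ))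
  rwa [← mul_assoc, ← ENNReal.ofReal_mul (Real.exp_pos _).le, ← ENNReal.ofReal_mul
    (Real.exp_pos _).le, ← Real.exp_add, ← Real.exp_add, add_neg_cancel, Real.exp_zero,
    ENNReal.ofReal_one, one_mul, ← sub_eq_add_neg] at h2

end TabularMDP

/-! ### The high-probability bound -/

namespace TabularMDP

variable {S A : Type*} [Fintype S] [Fintype A] {H n M N : ℕ}

/-- The accumulated error of the folds is bounded by the exponent of the supermartingale plus a
sub-Gaussian term; the coefficient of the squared returns is chosen as small as the cancellation
of the quadratic terms permits. -/
theorem mul_sum_tmis_sub_le (𝓜 : TabularMDP S A H) (π : Policy S A H)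
    (e : Fin N × Fin M ≃ Fin n) (D : Fin n → Episode S A H) {R : ℝ} (hR0 : 0 ≤ R)
    (hR : 𝓜.RewardsBounded R) (hD : ∀ t k, (D k).reward t ∈ Set.Icc 0 R) {τ θ : ℝ} (hτ : 0 < τ)
    (hτM : τ ≤ M) (hv : ∀ i t s a, τ ≤ visits (fold e D i) t s a)
    (hθ : |θ| * (H * R) / τ ≤ 1 / 8) :
    θ * (∑ i, tmis (fold e D i) π - N * ∑ s, 𝓜.init s * 𝓜.stateValue π 0 s) ≤
      𝓜.dataExponent π e τ (H * R) θ (4 * θ ^ 2 / τ) D + 9 * (N * (θ ^ 2 * (H * R) ^ 2 / τ)) := by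
  have hM : (0 : ℝ) < M := hτ.trans_le hτM
  set B := H * R with hB
  have hB0 : 0 ≤ B := by positivity
  set v := ∑ s, 𝓜.init s * 𝓜.stateValue π 0 s with hvdef
  set φ := 4 * θ ^ 2 / τ with hφ
  have hφ0 : 0 ≤ φ := by positivity
  have hsq : (|θ| * B / τ) ^ 2 ≤ (1 / 8) ^ 2 := pow_le_pow_left₀ (by positivity) hθ 2
  -- the domination `1 / τ * (2 θ ^ 2 + 8 φ ^ 2 B ^ 2) ≤ φ` that cancels the variances
  have hdom : 1 / τ * (2 * θ ^ 2 + 8 * φ ^ 2 * B ^ 2) ≤ φ := by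
    rw [div_pow, mul_pow, sq_abs] at hsq
    have : 1 / τ * (2 * θ ^ 2 + 8 * φ ^ 2 * B ^ 2) =
        2 * θ ^ 2 / τ + 128 * (θ ^ 2 / τ) * (θ ^ 2 * B ^ 2 / τ ^ 2) := by
      rw [hφ]; field_simp; ring
    rw [this]
    have h2 := mul_le_mul_of_nonneg_left hsq (by positivity : 0 ≤ 128 * (θ ^ 2 / τ))
    refine (add_le_add_right h2 _).trans (le_of_eq ?_)
    rw [hφ]; ring
  have hfold : ∀ i, θ * tmis (fold e D i) π ≤
      (∑ j, θ / M * 𝓜.stateValue π 0 ((D (e (i, j))).state 0) +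
      ∑ j, ∑ t, 𝓜.stepExponent π B θ φ t (truncWeight e π τ t (e (i, j)) D) (D (e (i, j)))) +
        2 * φ * B ^ 2 := fun i => by
    have hv0 : ∀ t s a, visits (fold e D i) t s a ≠ 0 := fun t s a h => by
      have := hv i t s a
      rw [h, Nat.cast_zero] at this
      linarith
    have h := 𝓜.mul_tmis_sub_le (fold e D i) π hv0 hR0 hR (fun t j => hD t _) hφ0
      (fun t j => visitWeight_le _ _ _ _ _ hτ (hv i t _ _)) hdom
    simp only [truncWeight_eq e π _ D i _ (hv i _)]
    rw [← Finset.mul_sum]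
    rw [mul_sub, Fintype.card_fin] at h
    have h3 : θ / M * ∑ j, 𝓜.stateValue π 0 ((D (e (i, j))).state 0) =
        θ * ((∑ j, 𝓜.stateValue π 0 ((fold e D i j).state 0)) / M) := by
      simp only [fold]; ring
    rw [h3]
    simp only [fold] at h ⊢
    linarith
  have hsum := Finset.sum_le_sum fun i (_ : i ∈ Finset.univ) => hfold i
  rw [Finset.sum_add_distrib, Finset.sum_add_distrib, ← Finset.mul_sum, ← sum_folds e fun k =>
    ∑ t, 𝓜.stepExponent π B θ φ t (truncWeight e π τ t k D) (D k),
    ← sum_folds e fun k => θ / M * 𝓜.stateValue π 0 ((D k).state 0)] at hsum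
  simp only [Finset.sum_const, Finset.card_univ, Fintype.card_fin, nsmul_eq_mul] at hsum
  have hn : (n : ℝ) = N * M := by
    have := Fintype.card_congr e
    simp only [Fintype.card_prod, Fintype.card_fin] at this
    exact_mod_cast this.symm
  have hinit : ∑ k, (θ / M * (𝓜.stateValue π 0 ((D k).state 0) - v) - (θ / M) ^ 2 * B ^ 2) =
      ∑ k, θ / M * 𝓜.stateValue π 0 ((D k).state 0) - θ * (N * v) -
        N * (θ ^ 2 * B ^ 2 / M) := by
    simp only [mul_sub, Finset.sum_sub_distrib, Finset.sum_const, Finset.card_univ,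
      Fintype.card_fin, nsmul_eq_mul, hn]
    field_simp
  have hlast : N * (θ ^ 2 * B ^ 2 / M) ≤ N * (θ ^ 2 * B ^ 2 / τ) := by gcongr
  have hφ2 : N * (2 * φ * B ^ 2) = 8 * (N * (θ ^ 2 * B ^ 2 / τ)) := by rw [hφ]; ring
  rw [dataExponent, hinit]
  linarith

variable [MeasurableSpace S] [MeasurableSpace A]
  [MeasurableSingletonClass S] [MeasurableSingletonClass A]

/-- The deviation bound for the averaged estimator, for any level `l` of confidence and any
threshold `τ` that is at most a quarter of the expected number of visits. -/
theorem measure_splitTmis_sub_value_gt_le (𝓜 : TabularMDP S A H) (μ π : Policy S A H)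
    (e : Fin N × Fin M ≃ Fin n) {R : ℝ} (hR0 : 0 < R) (hR : 𝓜.RewardsBounded R) {τ l : ℝ}
    (hτ : 0 < τ) (hτM : τ ≤ M) (hvis : ∀ t s a, τ ≤ M * 𝓜.stateActionDist μ t s a / 4)
    (hH : 0 < H) (hN : 0 < N) (hl : 0 < l) (hlτ : l / (τ * N) ≤ 1 / 64) :
    (Measure.pi fun _ : Fin n => 𝓜.episodeLaw μ)
      {D | 10 * (H * R) * √(l / (τ * N)) < |splitTmis e D π - 𝓜.value π|} ≤
      ENNReal.ofReal (2 * Real.exp (-l) +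
        N * H * (Fintype.card S * Fintype.card A) * Real.exp (-τ)) := by
  have hB : 0 < H * R := by positivity
  have hN' : (0 : ℝ) < N := by exact_mod_cast hN
  have hM : (0 : ℝ) < M := hτ.trans_le hτM
  set B := H * R with hBdef
  set x := √(l / (τ * N)) with hx
  have hx0 : 0 < x := Real.sqrt_pos.2 (by positivity)
  have hx2 : x ^ 2 = l / (τ * N) := Real.sq_sqrt (by positivity)
  have hx8 : x ≤ 1 / 8 := by
    rw [hx, Real.sqrt_le_iff]
    norm_num
    exact hlτ
  set ν := Measure.pi fun _ : Fin n => 𝓜.episodeLaw μ with hν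
  -- the value of `θ` that balances the two terms of the exponential bound
  set θ := τ * x / B with hθ
  have hθ0 : 0 < θ := by positivity
  have hθB : |θ| * B / τ ≤ 1 / 8 := by
    rw [abs_of_pos hθ0, hθ]
    refine le_of_eq_of_le ?_ hx8
    field_simp
  have hθB' : |(-θ)| * B / τ ≤ 1 / 8 := by rwa [abs_neg]
  have hexp : ∀ θ' : ℝ, |θ'| * B / τ ≤ 1 / 8 →
      ν {D | l ≤ 𝓜.dataExponent π e τ B θ' (4 * θ' ^ 2 / τ) D} ≤
        ENNReal.ofReal (Real.exp (-l)) := fun θ' h => by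
    refine 𝓜.measure_dataExponent_ge_le μ π e hR0.le hR hτ (by positivity) ?_ ?_ l
    · rw [abs_div, Nat.abs_cast, div_mul_eq_mul_div]
      refine (div_le_div_of_nonneg_left (by positivity) hτ hτM).trans (h.trans (by norm_num))
    · have h2 : (|θ'| * B / τ) ^ 2 ≤ (1 / 8) ^ 2 := pow_le_pow_left₀ (by positivity) h 2
      have h3 : 1 / τ * (|θ'| * B + 4 * θ' ^ 2 / τ * B ^ 2) =
          |θ'| * B / τ + 4 * (|θ'| * B / τ) ^ 2 := by
        rw [← sq_abs θ']; field_simp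
      rw [← hBdef, h3]
      linarith
  have hlow : ν (⋃ q : Fin N × Fin H × S × A,
      {D | (visits (fold e D q.1) q.2.1 q.2.2.1 q.2.2.2 : ℝ) ≤ τ}) ≤
      ENNReal.ofReal (N * H * (Fintype.card S * Fintype.card A) * Real.exp (-τ)) := by
    refine (measure_iUnion_fintype_le _ _).trans ((Finset.sum_le_sum fun q _ =>
      (𝓜.measure_visits_lt_le μ e q.1 q.2.1 q.2.2.1 q.2.2.2 τ).trans
      (ENNReal.ofReal_le_ofReal (Real.exp_le_exp.2 (show _ ≤ -τ by
        linarith [hvis q.2.1 q.2.2.1 q.2.2.2])))).trans (le_of_eq ?_))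
    rw [Finset.sum_const, Finset.card_univ, nsmul_eq_mul, ← ENNReal.ofReal_natCast,
      ← ENNReal.ofReal_mul (by positivity)]
    simp only [Fintype.card_prod, Fintype.card_fin]
    congr 1
    push_cast
    ring
  have hrew : ν {D | ¬ ∀ t k, (D k).reward t ∈ Set.Icc 0 R} = 0 := by
    change ∀ᵐ D ∂ν, ∀ t k, (D k).reward t ∈ Set.Icc 0 R
    refine ae_all_iff.2 fun t => ae_all_iff.2 fun k => ?_
    exact (Measure.quasiMeasurePreserving_eval (fun _ : Fin n => 𝓜.episodeLaw μ) k).ae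
      (𝓜.ae_reward_mem μ hR t)
  have hsub : {D | 10 * B * x < |splitTmis e D π - 𝓜.value π|} ⊆
      (({D | l ≤ 𝓜.dataExponent π e τ B θ (4 * θ ^ 2 / τ) D} ∪
      {D | l ≤ 𝓜.dataExponent π e τ B (-θ) (4 * (-θ) ^ 2 / τ) D}) ∪
      ⋃ q : Fin N × Fin H × S × A,
        {D | (visits (fold e D q.1) q.2.1 q.2.2.1 q.2.2.2 : ℝ) ≤ τ}) ∪
      {D | ¬ ∀ t k, (D k).reward t ∈ Set.Icc 0 R} := by
    intro D hD
    by_contra hcon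
    simp only [Set.mem_union, Set.mem_ofPred_eq, Set.mem_iUnion, not_or, not_exists, not_le,
      not_not] at hcon
    obtain ⟨⟨⟨h1, h2⟩, h3⟩, h4⟩ := hcon
    have hv : ∀ i t s a, τ ≤ visits (fold e D i) t s a := fun i t s a => (h3 (i, t, s, a)).le
    have e1 := 𝓜.mul_sum_tmis_sub_le π e D hR0.le hR h4 hτ hτM hv hθB
    have e2 := 𝓜.mul_sum_tmis_sub_le π e D hR0.le hR h4 hτ hτM hv hθB'
    rw [← 𝓜.value_eq_sum_init π hR, ← hBdef] at e1 e2
    have hsplit : ∑ i, tmis (fold e D i) π - N * 𝓜.value π =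
        N * (splitTmis e D π - 𝓜.value π) := by
      rw [splitTmis, mul_sub, mul_div_cancel₀ _ hN'.ne']
      rfl
    have hbal : N * (θ ^ 2 * B ^ 2 / τ) = l := by
      rw [hθ, div_pow, mul_pow, hx2]; field_simp
    rw [hsplit] at e1 e2
    rw [neg_sq] at e2 h2
    rw [hbal] at e1 e2
    have hb : θ * (N * (10 * B * x)) = 10 * l := by
      rw [← hbal, hθ]; field_simp
    have : |splitTmis e D π - 𝓜.value π| ≤ 10 * B * x := by
      have hpos : 0 < θ * N := by positivity
      rw [abs_le]
      constructor
      · refine le_of_mul_le_mul_left ?_ hpos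
        linarith
      · refine le_of_mul_le_mul_left ?_ hpos
        linarith
    exact absurd hD (not_lt.2 this)
  calc _ ≤ ((ENNReal.ofReal (Real.exp (-l)) + ENNReal.ofReal (Real.exp (-l))) +
        ENNReal.ofReal (N * H * (Fintype.card S * Fintype.card A) * Real.exp (-τ))) + 0 := by
        refine (measure_mono hsub).trans ((measure_union_le _ _).trans ?_)
        refine add_le_add ((measure_union_le _ _).trans (add_le_add ((measure_union_le _ _).trans
          (add_le_add (hexp θ hθB) (hexp (-θ) hθB'))) hlow)) hrew.le
    _ = _ := by
      rw [add_zero, ← ENNReal.ofReal_add (by positivity) (by positivity),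
        ← ENNReal.ofReal_add (by positivity) (by positivity), two_mul]

end TabularMDP

namespace TabularMDP

variable {S A : Type*} [Fintype S] [Fintype A] [MeasurableSpace S] [MeasurableSpace A]
  [MeasurableSingletonClass S] [MeasurableSingletonClass A] {H n M N : ℕ}

/-- A version of the deviation bound that includes the degenerate case `R = 0`, in which the
exponential parameter is infinite; it is the limit of the bounds for larger `R`. -/
theorem measure_splitTmis_sub_value_gt_le' (𝓜 : TabularMDP S A H) (μ π : Policy S A H)
    (e : Fin N × Fin M ≃ Fin n) {R : ℝ} (hR0 : 0 ≤ R) (hR : 𝓜.RewardsBounded R) {τ l : ℝ}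
    (hτ : 0 < τ) (hτM : τ ≤ M) (hvis : ∀ t s a, τ ≤ M * 𝓜.stateActionDist μ t s a / 4)
    (hH : 0 < H) (hN : 0 < N) (hl : 0 < l) (hlτ : l / (τ * N) ≤ 1 / 64) :
    (Measure.pi fun _ : Fin n => 𝓜.episodeLaw μ)
      {D | 10 * (H * R) * √(l / (τ * N)) < |splitTmis e D π - 𝓜.value π|} ≤
      ENNReal.ofReal (2 * Real.exp (-l) +
        N * H * (Fintype.card S * Fintype.card A) * Real.exp (-τ)) := by
  set x := √(l / (τ * N))
  let E : ℕ → Set (Fin n → Episode S A H) := fun m =>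
    {D | 10 * (H * (R + 1 / ((m : ℝ) + 1))) * x < |splitTmis e D π - 𝓜.value π|}
  have hmono : Monotone E := fun m m' hmm D hD => by
    simp only [E, Set.mem_ofPred_eq] at hD ⊢
    refine lt_of_le_of_lt ?_ hD
    have : (1 : ℝ) / (m' + 1) ≤ 1 / (m + 1) := by
      have : (m : ℝ) ≤ m' := by exact_mod_cast hmm
      gcongr
    gcongr
  have hsub : {D | 10 * (H * R) * x < |splitTmis e D π - 𝓜.value π|} ⊆ ⋃ m, E m := by
    intro D hD
    have hlim : Filter.Tendsto (fun m : ℕ => 10 * (H * (R + 1 / ((m : ℝ) + 1))) * x)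
        Filter.atTop (nhds (10 * (H * (R + 0)) * x)) :=
      (((tendsto_one_div_add_atTop_nhds_zero_nat.const_add R).const_mul _).const_mul _).mul_const _
    rw [add_zero] at hlim
    obtain ⟨m, hm⟩ := (hlim.eventually_lt_const hD).exists
    exact Set.mem_iUnion.2 ⟨m, hm⟩
  refine (measure_mono hsub).trans ?_
  rw [hmono.measure_iUnion]
  refine iSup_le fun m => 𝓜.measure_splitTmis_sub_value_gt_le μ π e (by positivity)
    (fun t s a s' => ?_) hτ hτM hvis hH hN hl hlτ
  filter_upwards [hR t s a s'] with r hr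
  exact ⟨hr.1, hr.2.trans (le_add_of_nonneg_right (by positivity))⟩

end TabularMDP

end OPE

theorem theorem3 (c K : ℝ) (hc : 0 < c) (hK : 0 < K) (p₀ : ℕ) :
    ∃ (C₁ : ℝ) (p₁ : ℕ) (C₂ : ℝ) (C₃ : ℝ) (p₃ : ℕ), 0 < C₁ ∧ 0 < C₂ ∧ 0 < C₃ ∧
      ∀ (S : Type*) (A : Type*) [Fintype S] [Fintype A]
        [MeasurableSpace S] [MeasurableSingletonClass S]
        [MeasurableSpace A] [MeasurableSingletonClass A]
        (H : ℕ) (Rmax : ℝ) (𝓜 : OPE.TabularMDP S A H) (μ π : OPE.Policy S A H)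
        (n M N : ℕ) (e : Fin N × Fin M ≃ Fin n) (δ : ℝ),
        𝓜.RewardsBounded Rmax → 𝓜.NearUniform μ c →
        1 < M → 1 < N → n = M * N → 0 < δ → δ < 1 →
        (M : ℝ) ≤ K * OPE.logFactor S A H n δ ^ p₀ *
          (n * (Fintype.card S * Fintype.card A)) →
        max (C₁ * (Fintype.card S * Fintype.card A * OPE.logFactor S A H n δ ^ p₁))
          (C₂ * (H * OPE.tauA π μ * 𝓜.tauS π μ)) < (M : ℝ) →
        1 - δ ≤ (MeasureTheory.Measure.pi fun _ : Fin n => 𝓜.episodeLaw μ).real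
          {D | |OPE.splitTmis e D π - 𝓜.value π| ≤
            C₃ * OPE.logFactor S A H n δ ^ p₃ *
              (Rmax * √((H : ℝ) ^ 2 * Fintype.card S * Fintype.card A / n))} := by
  -- `256 / c` makes the threshold `τ = c M / (4 |S| |A|)` for the visits at least `64 L`; this
  -- covers both the union bound over folds, steps and pairs and the range of `θ`
  refine ⟨256 / c, 1, 1, 20 / √c, 1, by positivity, one_pos, by positivity, ?_⟩
  intro S A _ _ _ _ _ _ H R 𝓜 μ π n M N e δ hR hμ hM hN hn hδ0 hδ1 _ hmax
  rcases Nat.eq_zero_or_pos H with rfl | hH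
  · -- without steps both the estimator and the value vanish
    simp [OPE.splitTmis, OPE.tmis, OPE.TabularMDP.value, hδ0.le]
  have hS : Nonempty S := by
    by_contra h
    rw [not_nonempty_iff] at h
    have := 𝓜.init_mem.2
    simp at this
  have hA : Nonempty A := by
    by_contra h
    rw [not_nonempty_iff] at h
    have := (μ.prob_mem ⟨0, hH⟩ (Classical.arbitrary S)).2
    simp at this
  have hR0 : 0 ≤ R := by
    obtain ⟨r, hr⟩ := (hR ⟨0, hH⟩ (Classical.arbitrary S) (Classical.arbitrary A)
      (Classical.arbitrary S)).exists
    exact hr.1.trans hr.2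
  set L := OPE.logFactor S A H n δ with hL
  set k : ℝ := Fintype.card S * Fintype.card A with hk
  have hS1 : (1 : ℝ) ≤ Fintype.card S := by exact_mod_cast Fintype.card_pos
  have hA1 : (1 : ℝ) ≤ Fintype.card A := by exact_mod_cast Fintype.card_pos
  have hk1 : 1 ≤ k := one_le_mul_of_one_le_of_one_le hS1 hA1
  have hH1 : (1 : ℝ) ≤ H := by exact_mod_cast hH
  have hM2 : (2 : ℝ) ≤ M := by exact_mod_cast hM
  have hN2 : (2 : ℝ) ≤ N := by exact_mod_cast hN
  have hnMN : (n : ℝ) = M * N := by rw [hn]; push_cast; ring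
  have hn4 : (4 : ℝ) ≤ n := by rw [hnMN]; nlinarith
  have hkH : 1 ≤ k * H := one_le_mul_of_one_le_of_one_le hk1 hH1
  have hLlog : L = Real.log (k * H * n / δ) := by
    rw [hL, OPE.logFactor, hk]; ring_nf
  have hlL : Real.log (4 / δ) ≤ L := by
    rw [hLlog]
    refine Real.log_le_log (by positivity) ?_
    gcongr
    nlinarith
  have hl1 : 1 ≤ Real.log (4 / δ) := by
    rw [Real.le_log_iff_exp_le (by positivity)]
    have h1 : 4 ≤ 4 / δ := (le_div_iff₀ hδ0).2 (by linarith)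
    linarith [Real.exp_one_lt_d9]
  have hL1 : 1 ≤ L := hl1.trans hlL
  have hML : 256 / c * (k * L) ≤ M := by
    have := (le_max_left _ _).trans hmax.le
    rwa [pow_one] at this
  set τ := c * M / (4 * k) with hτdef
  have hτ0 : 0 < τ := by positivity
  have hτL : 64 * L ≤ τ := by
    rw [hτdef, le_div_iff₀ (by positivity)]
    rw [div_mul_eq_mul_div, div_le_iff₀ hc] at hML
    linarith
  have hvis : ∀ t s a, τ ≤ M * 𝓜.stateActionDist μ t s a / 4 := fun t s a => by
    have := mul_le_mul_of_nonneg_left (hμ t s a) (by positivity : (0 : ℝ) ≤ M / 4)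
    refine le_trans (le_of_eq ?_) (this.trans (le_of_eq (by ring)))
    rw [hτdef, hk]; field_simp
  have hτM : τ ≤ M := by
    refine (hvis ⟨0, hH⟩ (Classical.arbitrary S) (Classical.arbitrary A)).trans ?_
    have : 𝓜.stateActionDist μ ⟨0, hH⟩ (Classical.arbitrary S) (Classical.arbitrary A) ≤ 1 :=
      MeasureTheory.measureReal_le_one
    nlinarith
  have hlτ : Real.log (4 / δ) / (τ * N) ≤ 1 / 64 := by
    rw [div_le_iff₀ (by positivity)]
    nlinarith
  have hbad := 𝓜.measure_splitTmis_sub_value_gt_le' μ π e hR0 hR hτ0 hτM hvis hH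
    (by omega) (by linarith) hlτ
  have hprob : 2 * Real.exp (-Real.log (4 / δ)) + N * H * k * Real.exp (-τ) ≤ δ := by
    have h1 : Real.exp (-Real.log (4 / δ)) = δ / 4 := by
      rw [Real.exp_neg, Real.exp_log (by positivity), inv_div]
    have h2 : Real.exp (-τ) ≤ δ / (k * H * n) := by
      calc Real.exp (-τ) ≤ Real.exp (-L) := Real.exp_le_exp.2 (by linarith)
        _ = δ / (k * H * n) := by
          rw [hLlog, Real.exp_neg, Real.exp_log (by positivity), inv_div]
    have h3 : N * H * k * Real.exp (-τ) ≤ δ / 2 := by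
      calc _ ≤ N * H * k * (δ / (k * H * n)) := by gcongr
        _ = δ / M := by rw [hnMN]; field_simp
        _ ≤ δ / 2 := by gcongr
    rw [h1]
    linarith
  have hbound : 10 * (H * R) * √(Real.log (4 / δ) / (τ * N)) ≤
      20 / √c * L ^ 1 * (R * √((H : ℝ) ^ 2 * Fintype.card S * Fintype.card A / n)) := by
    have h1 : √(Real.log (4 / δ) / (τ * N)) ≤ 2 / √c * L * √(k / n) := by
      rw [Real.sqrt_le_iff]
      refine ⟨by positivity, ?_⟩
      rw [mul_pow, mul_pow, div_pow, Real.sq_sqrt hc.le, Real.sq_sqrt (by positivity)]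
      have h2 : (2 : ℝ) ^ 2 / c * L ^ 2 * (k / n) = L ^ 2 / (τ * N) := by
        rw [hτdef, hnMN]; field_simp; norm_num
      rw [h2]
      gcongr
      nlinarith
    have h2 : √((H : ℝ) ^ 2 * Fintype.card S * Fintype.card A / n) = H * √(k / n) := by
      rw [mul_assoc, ← hk, mul_div_assoc, Real.sqrt_mul (by positivity),
        Real.sqrt_sq (by positivity)]
    rw [h2]
    calc _ ≤ 10 * (H * R) * (2 / √c * L * √(k / n)) := by gcongr
      _ = _ := by ring
  set ν := MeasureTheory.Measure.pi fun _ : Fin n => 𝓜.episodeLaw μ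
  have hbad' := ENNReal.toReal_le_of_le_ofReal hδ0.le
    (hbad.trans (ENNReal.ofReal_le_ofReal hprob))
  set good := {D | |OPE.splitTmis e D π - 𝓜.value π| ≤ 20 / √c * L ^ 1 *
    (R * √((H : ℝ) ^ 2 * Fintype.card S * Fintype.card A / n))} with hgood
  set bad := {D | 10 * (H * R) * √(Real.log (4 / δ) / (τ * N)) <
    |OPE.splitTmis e D π - 𝓜.value π|} with hbadset
  have huniv : good ∪ bad = Set.univ := Set.eq_univ_of_forall fun D =>
    (le_or_gt (|OPE.splitTmis e D π - 𝓜.value π|) _).imp (fun h => h.trans hbound) id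
  have hunion := MeasureTheory.measureReal_union_le (μ := ν) good bad
  rw [huniv, MeasureTheory.probReal_univ] at hunion
  have hbad2 : ν.real bad ≤ δ := hbad'
  linarith
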